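/- Let $1\le\ell\le n$ and let $\theta\in C_0^\infty(\mathbb R^n)$ be real-valued with $\int\theta(x)\,dx=1$. For $x\ne y$ put $$G_\ell(x,y)=\int_1^\infty (t-1)^{n-\ell}\,t^{\ell-1}\,\theta\bigl(y+t(x-y)\bigr)\,dt .$$ For a differential form $u\in C_0^\infty(\mathbb R^n,\Lambda^\ell)$ (smooth, compactly supported, of order $\ell$, with real or complex coefficients) define the regularized Poincaré-type operator and the Bogovskiĭ-type operator $$R_\ell u(x)=\int_{\mathbb R^n} G_{n-\ell+1}(y,x)\,(x-y)\lrcorner u(y)\,dy,\qquad T_\ell u(x)=\int_{\mathbb R^n} G_\ell(x,y)\,(x-y)\lrcorner u(y)\,dy ,$$ where $a\lrcorner u$ denotes the contraction of a vector $a$ with the form $u$. Then these integrals converge absolutely for every such $u$ and every $x\in\mathbb R^n$, and both $R_\ell$ and $T_\ell$ are pseudodifferential operators on $\mathbb R^n$ of order $-1$ with symbols in the Hörmander class $S^{-1}_{1,0}(\mathbb R^n)$. Here $S^{m}_{1,0}(\mathbb R^n)$ is the local symbol class: the functions $a\in C^\infty(\mathbb R^n\times\mathbb R^n)$ such that for every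 compact $M\subset\mathbb R^n$ and all multi-indices $\alpha,\beta$ there is a constant $C_{\alpha\beta}(M)$ with $$|\partial_x^\alpha\partial_\xi^\beta a(x,\xi)|\le C_{\alpha\beta}(M)\,(1+|\xi|)^{m-|\beta|}\qquad\text{for all }(x,\xi)\in M\times\mathbb R^n ;$$ a symbol with values in the linear maps $\Lambda^\ell_{\mathbb C}\to\Lambda^{\ell-1}_{\mathbb C}$ between the complexified spaces of forms belongs to the class if all its coefficients do. An operator $A$ that maps forms in $C_0^\infty(\mathbb R^n,\Lambda^\ell)$ to $\Lambda^{\ell-1}$-valued functions on $\mathbb R^n$ is a pseudodifferential operator of order $m$ with symbol $a\in S^m_{1,0}(\mathbb R^n)$ if there is a $C^\infty$ kernel $k$ on $\mathbb R^n\times\mathbb R^n$ with values in the same linear maps such that, for all $u\in C_0^\infty(\mathbb R^n,\Lambda^\ell)$ and all $x\in\mathbb R^n$, $$Au(x)=\int_{\mathbb R^n} k(x,y)\,u(y)\,dy+(2\pi)^{-n}\int_{\mathbb R^n} e^{i\langle\xi,x\rangle}\,a(x,\xi)\,\hat u(\xi)\,d\xi,\qquad \hat u(\xi)=\int_{\mathbb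 R^n} e^{-i\langle\xi,y\rangle}u(y)\,dy .$$ -/

import Mathlib

open MeasureTheory
open scoped ContDiff RealInnerProductSpace

noncomputable section

/-- Euclidean space `ℝⁿ`. -/
abbrev Euc (n : ℕ) : Type := EuclideanSpace ℝ (Fin n)

/-- Alternating `ℓ`-forms on `ℝⁿ` with complex coefficients (the complexification of `Λ^ℓ`).
A differential form of order `ℓ` on `ℝⁿ` is a function `Euc n → Form n ℓ`; real differential
forms are those whose values are real. -/
abbrev Form (n ℓ : ℕ) : Type := Euc n [⋀^Fin ℓ]→L[ℝ] ℂ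

/-- The contraction (interior product) `a ⌟ u` of a vector and an `ℓ`-form,
`(a ⌟ u)(v₂, …, v_ℓ) = u(a, v₂, …, v_ℓ)`; it is zero on `0`-forms. -/
def contract {n : ℕ} : {ℓ : ℕ} → Euc n → Form n ℓ → Form n (ℓ - 1)
  | 0, _, _ => 0
  | _ + 1, a, u => u.curryLeft a

/-- The kernel `G_ℓ(x, y) = ∫₁^∞ (t - 1)^(n - ℓ) t^(ℓ - 1) θ(y + t (x - y)) dt`, used for
`1 ≤ ℓ ≤ n` only, so that no subtraction in an exponent is truncated. For `x ≠ y` the integrand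
vanishes for large `t`. -/
def kernelG {n : ℕ} (θ : Euc n → ℝ) (ℓ : ℕ) (x y : Euc n) : ℝ :=
  ∫ t in Set.Ioi (1 : ℝ), (t - 1) ^ (n - ℓ) * t ^ (ℓ - 1) * θ (y + t • (x - y))

/-- The integrand `y ↦ G_{n-ℓ+1}(y, x) (x - y) ⌟ u(y)` of the Poincaré-type operator. -/
def poincareIntegrand {n : ℕ} (θ : Euc n → ℝ) (ℓ : ℕ) (u : Euc n → Form n ℓ) (x y : Euc n) :
    Form n (ℓ - 1) :=
  kernelG θ (n - ℓ + 1) y x • contract (x - y) (u y)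

/-- The integrand `y ↦ G_ℓ(x, y) (x - y) ⌟ u(y)` of the Bogovskiĭ-type operator. -/
def bogovskiiIntegrand {n : ℕ} (θ : Euc n → ℝ) (ℓ : ℕ) (u : Euc n → Form n ℓ) (x y : Euc n) :
    Form n (ℓ - 1) :=
  kernelG θ ℓ x y • contract (x - y) (u y)

/-- The regularized Poincaré-type operator `R_ℓ`. -/
def poincareOp {n : ℕ} (θ : Euc n → ℝ) (ℓ : ℕ) (u : Euc n → Form n ℓ) (x : Euc n) :
    Form n (ℓ - 1) :=
  ∫ y, poincareIntegrand θ ℓ u x y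

/-- The Bogovskiĭ-type operator `T_ℓ`. -/
def bogovskiiOp {n : ℕ} (θ : Euc n → ℝ) (ℓ : ℕ) (u : Euc n → Form n ℓ) (x : Euc n) :
    Form n (ℓ - 1) :=
  ∫ y, bogovskiiIntegrand θ ℓ u x y

/-- The partial derivative `∂_j f`. -/
def partialDeriv {n : ℕ} (j : Fin n) (f : Euc n → ℂ) : Euc n → ℂ :=
  fun x => fderiv ℝ f x (EuclideanSpace.single j 1)

/-- The partial derivative `∂^α f = ∂_1^{α_1} ⋯ ∂_n^{α_n} f` for a multi-index `α`. -/
def multiDeriv {n : ℕ} (α : Fin n → ℕ) (f : Euc n → ℂ) : Euc n → ℂ :=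
  (List.finRange n).foldr (fun j g => (partialDeriv j)^[α j] g) f

/-- The local Hörmander symbol class `S^m_{1,0}(ℝⁿ)` of scalar symbols: smooth functions `a(x, ξ)`
on `ℝⁿ × ℝⁿ` such that for every compact `M` and all multi-indices `α, β` there is a constant `C`
with `|∂_x^α ∂_ξ^β a(x, ξ)| ≤ C (1 + |ξ|)^(m - |β|)` for all `x ∈ M` and all `ξ`. -/
def IsSymbol {n : ℕ} (m : ℝ) (a : Euc n → Euc n → ℂ) : Prop :=
  ContDiff ℝ ∞ (fun p : Euc n × Euc n => a p.1 p.2) ∧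
  ∀ M : Set (Euc n), IsCompact M → ∀ α β : Fin n → ℕ, ∃ C : ℝ, ∀ x ∈ M, ∀ ξ : Euc n,
    ‖multiDeriv α (fun x' => multiDeriv β (fun ξ' => a x' ξ') ξ) x‖
      ≤ C * (1 + ‖ξ‖) ^ (m - ((∑ j, β j : ℕ) : ℝ))

/-- A symbol whose values are linear maps from `ℓ`-forms to `ℓ'`-forms belongs to `S^m_{1,0}(ℝⁿ)`
when all its coefficients do: the coefficients are the scalar functions
`(x, ξ) ↦ (a(x, ξ) w)(v₁, …, v_ℓ')` for fixed `w` and fixed vectors `v₁, …, v_ℓ'`. -/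
def IsFormSymbol {n ℓ ℓ' : ℕ} (m : ℝ) (a : Euc n → Euc n → (Form n ℓ →ₗ[ℂ] Form n ℓ')) : Prop :=
  ∀ (w : Form n ℓ) (v : Fin ℓ' → Euc n), IsSymbol m (fun x ξ => a x ξ w v)

/-- An integral kernel whose values are linear maps from `ℓ`-forms to `ℓ'`-forms is smooth on
`ℝⁿ × ℝⁿ` when all its coefficients are. -/
def IsSmoothKernel {n ℓ ℓ' : ℕ} (k : Euc n → Euc n → (Form n ℓ →ₗ[ℂ] Form n ℓ')) : Prop :=
  ∀ (w : Form n ℓ) (v : Fin ℓ' → Euc n), ContDiff ℝ ∞ (fun p : Euc n × Euc n => k p.1 p.2 w v)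

/-- The Fourier transform `û(ξ) = ∫ e^{-i⟨ξ, y⟩} u(y) dy`. -/
def fourierHat {n ℓ : ℕ} (u : Euc n → Form n ℓ) (ξ : Euc n) : Form n ℓ :=
  ∫ y, Complex.exp (-(Complex.I * ((⟪ξ, y⟫ : ℝ) : ℂ))) • u y

/-- The quantization `Op(a) u(x) = (2π)^{-n} ∫ e^{i⟨ξ, x⟩} a(x, ξ) û(ξ) dξ` of a symbol `a`. -/
def quantize {n ℓ ℓ' : ℕ} (a : Euc n → Euc n → (Form n ℓ →ₗ[ℂ] Form n ℓ'))
    (u : Euc n → Form n ℓ) (x : Euc n) : Form n ℓ' :=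
  ((2 * Real.pi) ^ n)⁻¹ •
    ∫ ξ, Complex.exp (Complex.I * ((⟪ξ, x⟫ : ℝ) : ℂ)) • a x ξ (fourierHat u ξ)

/-- `A`, defined on smooth compactly supported forms, is a pseudodifferential operator on `ℝⁿ` of
order `m` with symbol in the local class `S^m_{1,0}(ℝⁿ)`: it is the quantization of such a symbol,
up to a smoothing operator, that is, an integral operator with a kernel that is smooth on
`ℝⁿ × ℝⁿ`. -/
def IsPseudodifferentialOperator {n ℓ ℓ' : ℕ} (m : ℝ)
    (A : (Euc n → Form n ℓ) → (Euc n → Form n ℓ')) : Prop :=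
  ∃ a : Euc n → Euc n → (Form n ℓ →ₗ[ℂ] Form n ℓ'), IsFormSymbol m a ∧
  ∃ k : Euc n → Euc n → (Form n ℓ →ₗ[ℂ] Form n ℓ'), IsSmoothKernel k ∧
    ∀ u : Euc n → Form n ℓ, ContDiff ℝ ∞ u → HasCompactSupport u →
      ∀ x, A u x = (∫ y, k x y (u y)) + quantize a u x

end

/-! Put z = x - y. Both kernels reduce to K(x, z) = ∫₁^∞ sⁿ⁻¹ p(1/s) θ(x + σsz) ds with p a
polynomial and σ = ±1. The Poincaré kernel is exactly K with σ = -1, p(r) = (1 - r)^(ℓ-1). For the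
Bogovskiĭ kernel, the shift t = s + 1 gives an integral over s > 0: the part s < 1 is smooth in (x,
y), hence smoothing, and the part s > 1 is K with σ = 1, p(r) = (1 + r)^(ℓ-1).

Substituting s = 1/r and z = rw turns integration against K(x, z) z_j into the average ∫₀¹ ∫ p(r)
θ(x + σw) w_j U(x - rw) dw dr. The factor z_j = r w_j supplies the power of r that makes the double
integral absolutely convergent (`integrable_radial_smul`, `integral_radialKernel_smul`). Fourier
inversion of U and Fubini then exhibit the average as a quantization
(`integral_smul_comp_sub_smul_eq`).

Carrying out the w-integral in the symbol leaves terms q(x) ∫₀¹ p(r) e^{iσr⟨ξ,x⟩} ψ(rξ) dr with ψ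
Schwartz (`oscSum_radialSymbol`). Each ξ-derivative produces a factor r; an x-derivative of the
phase produces rξ_j, which ψ absorbs. With weight r^b the integral is O((1 + |ξ|)^(-b-1)), so these
terms are symbols of order -1 (`exists_norm_oscAverage_le`, `OscSum.isSymbol`). -/

/-! ### Differentiation under the integral sign and partial derivatives. -/

/-- Joint continuity bounds the x-derivative on the compact set (closed unit ball) × [a, b], so a
constant serves as dominating function. -/
theorem hasFDerivAt_intervalIntegral_of_contDiff {E G : Type*} [NormedAddCommGroup E]
    [NormedSpace ℝ E] [ProperSpace E] [NormedAddCommGroup G] [NormedSpace ℝ G]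
    {F : E → ℝ → G} (hF : ContDiff ℝ 1 (fun q : E × ℝ => F q.1 q.2)) (a b : ℝ) (x₀ : E) :
    HasFDerivAt (fun x => ∫ r in a..b, F x r)
      (∫ r in a..b, (fderiv ℝ (fun q : E × ℝ => F q.1 q.2) (x₀, r)).comp
        (ContinuousLinearMap.inl ℝ E ℝ)) x₀ := by
  have hcont : Continuous fun q : E × ℝ => (fderiv ℝ (fun q : E × ℝ => F q.1 q.2) q).comp
      (ContinuousLinearMap.inl ℝ E ℝ) :=
    (hF.continuous_fderiv one_ne_zero).clm_comp continuous_const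
  obtain ⟨C, hC⟩ := ((isCompact_closedBall x₀ 1).prod
    (isCompact_uIcc (a := a) (b := b))).exists_bound_of_continuousOn hcont.continuousOn
  refine intervalIntegral.hasFDerivAt_integral_of_dominated_of_fderiv_le
    (F' := fun x r => (fderiv ℝ (fun q : E × ℝ => F q.1 q.2) (x, r)).comp
      (ContinuousLinearMap.inl ℝ E ℝ)) (bound := fun _ => C)
    (Metric.closedBall_mem_nhds x₀ one_pos) ?_ ?_ ?_ ?_ ?_ ?_
  · exact .of_forall fun x =>
      (hF.continuous.comp (by fun_prop : Continuous fun r : ℝ => (x, r))).aestronglyMeasurable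
  · exact (hF.continuous.comp
      (by fun_prop : Continuous fun r : ℝ => (x₀, r))).intervalIntegrable _ _
  · exact (hcont.comp (by fun_prop : Continuous fun r : ℝ => (x₀, r))).aestronglyMeasurable
  · exact .of_forall fun r hr x hx => hC (x, r) ⟨hx, Set.uIoc_subset_uIcc hr⟩
  · exact intervalIntegrable_const
  · refine .of_forall fun r _ x _ => ?_
    have h : HasFDerivAt (fun e : E => (e, r)) (ContinuousLinearMap.inl ℝ E ℝ) x :=
      hasFDerivAt_prodMk_left x r
    exact ((hF.differentiable one_ne_zero) (x, r)).hasFDerivAt.comp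
      (g := fun q : E × ℝ => F q.1 q.2) x h

/-- The derivative is again a parameter integral, now with values in `E →L[ℝ] G`. The induction
therefore quantifies over `G`, and keeping both spaces in `Type` keeps this space in the same
universe. -/
theorem contDiff_intervalIntegral_of_contDiff_nat {E : Type} [NormedAddCommGroup E]
    [NormedSpace ℝ E] [ProperSpace E] (a b : ℝ) (m : ℕ) :
    ∀ {G : Type} [NormedAddCommGroup G] [NormedSpace ℝ G] {F : E → ℝ → G},
      ContDiff ℝ ∞ (fun q : E × ℝ => F q.1 q.2) →
        ContDiff ℝ m (fun x => ∫ r in a..b, F x r) := by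
  induction m with
  | zero =>
    intro G _ _ F hF
    have hF' : ContDiff ℝ 1 (fun q : E × ℝ => F q.1 q.2) := hF.of_le (by norm_cast)
    exact contDiff_zero.2 (continuous_iff_continuousAt.2 fun x =>
      (hasFDerivAt_intervalIntegral_of_contDiff hF' a b x).continuousAt)
  | succ m ih =>
    intro G _ _ F hF
    have hF' : ContDiff ℝ 1 (fun q : E × ℝ => F q.1 q.2) := hF.of_le (by norm_cast)
    have hd := fun x => hasFDerivAt_intervalIntegral_of_contDiff hF' a b x
    push_cast
    refine contDiff_succ_iff_fderiv.2 ⟨fun x => (hd x).differentiableAt, by simp, ?_⟩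
    rw [show fderiv ℝ (fun x => ∫ r in a..b, F x r) = _ from funext fun x => (hd x).fderiv]
    refine ih (F := fun x r => (fderiv ℝ (fun q : E × ℝ => F q.1 q.2) (x, r)).comp
        (ContinuousLinearMap.inl ℝ E ℝ)) ?_
    exact (hF.fderiv_right (m := ∞) (by simp)).clm_comp contDiff_const

/-- An integral over a compact interval depends smoothly on parameters. -/
theorem contDiff_intervalIntegral_of_contDiff {E G : Type} [NormedAddCommGroup E]
    [NormedSpace ℝ E] [ProperSpace E] [NormedAddCommGroup G] [NormedSpace ℝ G]
    {F : E → ℝ → G} (hF : ContDiff ℝ ∞ (fun q : E × ℝ => F q.1 q.2)) (a b : ℝ) :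
    ContDiff ℝ ∞ (fun x => ∫ r in a..b, F x r) :=
  contDiff_infty.2 fun m => contDiff_intervalIntegral_of_contDiff_nat a b m hF

theorem HasFDerivAt.partialDeriv {n : ℕ} {f : Euc n → ℂ} {f' : Euc n →L[ℝ] ℂ} {x : Euc n}
    (h : HasFDerivAt f f' x) (j : Fin n) :
    partialDeriv j f x = f' (EuclideanSpace.single j 1) := by
  rw [_root_.partialDeriv, h.fderiv]

theorem partialDeriv_intervalIntegral {n : ℕ} {F : Euc n → ℝ → ℂ}
    (hF : ContDiff ℝ ∞ (fun q : Euc n × ℝ => F q.1 q.2)) (a b : ℝ) (j : Fin n) (x : Euc n) :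
    partialDeriv j (fun x => ∫ r in a..b, F x r) x
      = ∫ r in a..b, partialDeriv j (fun x => F x r) x := by
  have hF' : ContDiff ℝ 1 (fun q : Euc n × ℝ => F q.1 q.2) := hF.of_le (by norm_cast)
  rw [(hasFDerivAt_intervalIntegral_of_contDiff hF' a b x).partialDeriv,
    ContinuousLinearMap.intervalIntegral_apply]
  · refine intervalIntegral.integral_congr fun r _ => ?_
    exact (HasFDerivAt.partialDeriv (HasFDerivAt.comp (g := fun q : Euc n × ℝ => F q.1 q.2) x
      ((hF'.differentiable one_ne_zero) (x, r)).hasFDerivAt (hasFDerivAt_prodMk_left x r)) j).symm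
  · refine Continuous.intervalIntegrable ?_ _ _
    exact ((hF'.continuous_fderiv one_ne_zero).comp
      (by fun_prop : Continuous fun r : ℝ => (x, r))).clm_comp continuous_const

theorem partialDeriv_mul {n : ℕ} {f g : Euc n → ℂ} {x : Euc n} (hf : DifferentiableAt ℝ f x)
    (hg : DifferentiableAt ℝ g x) (j : Fin n) :
    partialDeriv j (fun x => f x * g x) x = f x * partialDeriv j g x + partialDeriv j f x * g x := by
  refine ((hf.hasFDerivAt.mul hg.hasFDerivAt).partialDeriv j).trans ?_
  simp [partialDeriv, mul_comm]

theorem partialDeriv_add {n : ℕ} {f g : Euc n → ℂ} {x : Euc n} (hf : DifferentiableAt ℝ f x)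
    (hg : DifferentiableAt ℝ g x) (j : Fin n) :
    partialDeriv j (fun x => f x + g x) x = partialDeriv j f x + partialDeriv j g x := by
  refine ((hf.hasFDerivAt.add hg.hasFDerivAt).partialDeriv j).trans ?_
  simp [partialDeriv]

theorem partialDeriv_const_mul {n : ℕ} {f : Euc n → ℂ} {x : Euc n} (hf : DifferentiableAt ℝ f x)
    (c : ℂ) (j : Fin n) :
    partialDeriv j (fun x => c * f x) x = c * partialDeriv j f x := by
  rw [(hf.hasFDerivAt.const_mul c).partialDeriv]
  simp [partialDeriv]

theorem contDiff_partialDeriv {n : ℕ} {f : Euc n → ℂ} (hf : ContDiff ℝ ∞ f) (j : Fin n) :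
    ContDiff ℝ ∞ (partialDeriv j f) :=
  (hf.fderiv_right (m := ∞) (by simp)).clm_apply contDiff_const

theorem partialDeriv_comp_smul {n : ℕ} {f : Euc n → ℂ} (hf : Differentiable ℝ f) (r : ℝ)
    (j : Fin n) (x : Euc n) :
    partialDeriv j (fun x => f (r • x)) x = (r : ℂ) * partialDeriv j f (r • x) := by
  refine (((hf (r • x)).hasFDerivAt.comp x
    ((hasFDerivAt_id x).const_smul r)).partialDeriv j).trans ?_
  simp [partialDeriv]

theorem partialDeriv_cexp_inner {n : ℕ} (c : ℝ) (j : Fin n) (x ξ : Euc n) :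
    partialDeriv j (fun ξ : Euc n => Complex.exp (Complex.I * ((c * ⟪ξ, x⟫ : ℝ) : ℂ))) ξ
      = (Complex.I * c * x j) * Complex.exp (Complex.I * ((c * ⟪ξ, x⟫ : ℝ) : ℂ)) := by
  have h1 : HasFDerivAt (fun ξ : Euc n => ((c * ⟪ξ, x⟫ : ℝ) : ℂ))
      (Complex.ofRealCLM.comp (c • innerSL ℝ x)) ξ := by
    have := (Complex.ofRealCLM.comp (c • innerSL ℝ x)).hasFDerivAt (x := ξ)
    convert this using 2
    simp [real_inner_comm]
  rw [((h1.const_mul Complex.I).cexp).partialDeriv]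
  simp [EuclideanSpace.inner_single_right]
  ring

/-! ### Oscillatory averages: derivatives and decay. -/

/-- The oscillatory average `∫₀¹ rᵇ p(r) e^{iσr⟨ξ, x⟩} ψ(rξ) dr`. -/
noncomputable def oscAverage {n : ℕ} (p : ℝ → ℂ) (σ : ℝ) (b : ℕ) (ψ : SchwartzMap (Euc n) ℂ) (x ξ : Euc n) :
    ℂ :=
  ∫ r in (0 : ℝ)..1, (r : ℂ) ^ b * p r *
    (Complex.exp (Complex.I * ((σ * r * ⟪ξ, x⟫ : ℝ) : ℂ)) * ψ (r • ξ))

section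
variable {n : ℕ} {p : ℝ → ℂ} {σ : ℝ}

theorem contDiff_oscAverage_integrand (hp : ContDiff ℝ ∞ p) (b : ℕ) (ψ : SchwartzMap (Euc n) ℂ) :
    ContDiff ℝ ∞ (fun q : (Euc n × Euc n) × ℝ => (q.2 : ℂ) ^ b * p q.2 *
      (Complex.exp (Complex.I * ((σ * q.2 * ⟪q.1.2, q.1.1⟫ : ℝ) : ℂ)) * ψ (q.2 • q.1.2))) := by
  have h1 : ContDiff ℝ ∞ (fun q : (Euc n × Euc n) × ℝ => (q.2 : ℂ)) :=
    Complex.ofRealCLM.contDiff.comp contDiff_snd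
  have h2 : ContDiff ℝ ∞ (fun q : (Euc n × Euc n) × ℝ => ((σ * q.2 * ⟪q.1.2, q.1.1⟫ : ℝ) : ℂ)) :=
    Complex.ofRealCLM.contDiff.comp ((contDiff_const.mul contDiff_snd).mul
      ((contDiff_snd.comp contDiff_fst).inner ℝ (contDiff_fst.comp contDiff_fst)))
  exact ((h1.pow b).mul (hp.comp contDiff_snd)).mul ((contDiff_const.mul h2).cexp.mul
    ((ψ.smooth ⊤).comp (contDiff_snd.smul (contDiff_snd.comp contDiff_fst))))

theorem contDiff_oscAverage (hp : ContDiff ℝ ∞ p) (b : ℕ) (ψ : SchwartzMap (Euc n) ℂ) :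
    ContDiff ℝ ∞ (fun q : Euc n × Euc n => oscAverage p σ b ψ q.1 q.2) :=
  contDiff_intervalIntegral_of_contDiff (contDiff_oscAverage_integrand hp b ψ) 0 1

theorem intervalIntegrable_oscAverage (hp : ContDiff ℝ ∞ p) (b : ℕ) (ψ : SchwartzMap (Euc n) ℂ)
    (x ξ : Euc n) : IntervalIntegrable (fun r : ℝ => (r : ℂ) ^ b * p r *
    (Complex.exp (Complex.I * ((σ * r * ⟪ξ, x⟫ : ℝ) : ℂ)) * ψ (r • ξ))) volume 0 1 :=
  ((contDiff_oscAverage_integrand hp b ψ).continuous.comp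
    (by fun_prop : Continuous fun r : ℝ => ((x, ξ), r))).intervalIntegrable _ _

/-- The variable ξ enters only through rξ, so either way of differentiating the product brings out a
factor r and raises the weight by one. This is the source of the gain in decay. -/
theorem partialDeriv_oscAverage_right (hp : ContDiff ℝ ∞ p) (b : ℕ) (ψ : SchwartzMap (Euc n) ℂ)
    (j : Fin n) (x ξ : Euc n) :
    partialDeriv j (oscAverage p σ b ψ x) ξ
      = Complex.I * σ * x j * oscAverage p σ (b + 1) ψ x ξ
        + oscAverage p σ (b + 1) (LineDeriv.lineDerivOp (EuclideanSpace.single j (1 : ℝ)) ψ) x ξ := by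
  have h := partialDeriv_intervalIntegral (F := fun (ξ : Euc n) (r : ℝ) => (r : ℂ) ^ b * p r *
    (Complex.exp (Complex.I * ((σ * r * ⟪ξ, x⟫ : ℝ) : ℂ)) * ψ (r • ξ)))
    ((contDiff_oscAverage_integrand hp b ψ).comp
      (g := fun q : (Euc n × Euc n) × ℝ => (q.2 : ℂ) ^ b * p q.2 *
      (Complex.exp (Complex.I * ((σ * q.2 * ⟪q.1.2, q.1.1⟫ : ℝ) : ℂ)) * ψ (q.2 • q.1.2)))
      (f := fun q : Euc n × ℝ => ((x, q.1), q.2)) (by fun_prop)) 0 1 j ξ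
  refine h.trans ?_
  unfold oscAverage
  rw [← intervalIntegral.integral_const_mul, ← intervalIntegral.integral_add
    ((intervalIntegrable_oscAverage hp _ _ _ _).const_mul _)
    (intervalIntegrable_oscAverage hp _ _ _ _)]
  refine intervalIntegral.integral_congr fun r _ => ?_
  have hψ : Differentiable ℝ ψ := ψ.differentiable
  have he : Differentiable ℝ fun ξ : Euc n =>
      Complex.exp (Complex.I * ((σ * r * ⟪ξ, x⟫ : ℝ) : ℂ)) :=
    (contDiff_const.mul (Complex.ofRealCLM.contDiff.comp (n := 1)
      (contDiff_const.mul (contDiff_id.inner ℝ contDiff_const)))).cexp.differentiable one_ne_zero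
  have hψr : Differentiable ℝ fun ξ : Euc n => ψ (r • ξ) :=
    hψ.comp (differentiable_id.const_smul r)
  simp only
  rw [partialDeriv_const_mul (f := fun ξ : Euc n =>
      Complex.exp (Complex.I * ((σ * r * ⟪ξ, x⟫ : ℝ) : ℂ)) * ψ (r • ξ)) ((he ξ).mul (hψr ξ)), partialDeriv_mul (he ξ) (hψr ξ),
    partialDeriv_cexp_inner, partialDeriv_comp_smul hψ, SchwartzMap.lineDerivOp_apply_eq_fderiv]
  simp only [partialDeriv]
  push_cast
  ring

/-- The factor rξ_j coming from the phase is the j-th coordinate at rξ, so it is absorbed into the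
Schwartz function. Nothing is lost in ξ and the weight does not change. -/
theorem partialDeriv_oscAverage_left (hp : ContDiff ℝ ∞ p) (b : ℕ) (ψ : SchwartzMap (Euc n) ℂ)
    (j : Fin n) (x ξ : Euc n) :
    partialDeriv j (fun x => oscAverage p σ b ψ x ξ) x
      = Complex.I * σ * oscAverage p σ b (SchwartzMap.smulLeftCLM ℂ
          (fun η : Euc n => ((η j : ℝ) : ℂ)) ψ) x ξ := by
  have h := partialDeriv_intervalIntegral (F := fun (x : Euc n) (r : ℝ) => (r : ℂ) ^ b * p r *
    (Complex.exp (Complex.I * ((σ * r * ⟪ξ, x⟫ : ℝ) : ℂ)) * ψ (r • ξ)))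
    ((contDiff_oscAverage_integrand hp b ψ).comp
      (g := fun q : (Euc n × Euc n) × ℝ => (q.2 : ℂ) ^ b * p q.2 *
      (Complex.exp (Complex.I * ((σ * q.2 * ⟪q.1.2, q.1.1⟫ : ℝ) : ℂ)) * ψ (q.2 • q.1.2)))
      (f := fun q : Euc n × ℝ => ((q.1, ξ), q.2)) (by fun_prop)) 0 1 j x
  refine h.trans ?_
  unfold oscAverage
  rw [← intervalIntegral.integral_const_mul]
  refine intervalIntegral.integral_congr fun r _ => ?_
  have he : Differentiable ℝ fun x : Euc n =>
      Complex.exp (Complex.I * ((σ * r * ⟪x, ξ⟫ : ℝ) : ℂ)) :=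
    (contDiff_const.mul (Complex.ofRealCLM.contDiff.comp (n := 1)
      (contDiff_const.mul (contDiff_id.inner ℝ contDiff_const)))).cexp.differentiable one_ne_zero
  have hg : Function.HasTemperateGrowth (fun η : Euc n => ((η j : ℝ) : ℂ)) :=
    (Complex.ofRealCLM.comp (EuclideanSpace.proj j)).hasTemperateGrowth
  have hcomm : (fun x : Euc n => (r : ℂ) ^ b * p r *
      (Complex.exp (Complex.I * ((σ * r * ⟪ξ, x⟫ : ℝ) : ℂ)) * ψ (r • ξ)))
      = fun x => ((r : ℂ) ^ b * p r * ψ (r • ξ)) *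
        Complex.exp (Complex.I * ((σ * r * ⟪x, ξ⟫ : ℝ) : ℂ)) := by
    funext x
    rw [real_inner_comm]
    ring
  simp only [SchwartzMap.smulLeftCLM_apply_apply hg]
  rw [hcomm, partialDeriv_const_mul (he x), partialDeriv_cexp_inner, real_inner_comm]
  simp
  ring

/-- The exponent b + 2 makes the integrand the exact derivative of (r/(1 + rc))^(b+1)/(b + 1). -/
theorem integral_pow_mul_inv_one_add_mul_pow (b : ℕ) {c : ℝ} (hc : 0 ≤ c) :
    ∫ r in (0 : ℝ)..1, r ^ b * ((1 + r * c) ^ (b + 2))⁻¹ = ((b + 1) * (1 + c) ^ (b + 1))⁻¹ := by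
  have hpos : ∀ r ∈ Set.uIcc (0 : ℝ) 1, 0 < 1 + r * c := by
    intro r hr
    rw [Set.uIcc_of_le zero_le_one] at hr
    have := mul_nonneg hr.1 hc
    linarith
  have h : ∀ r ∈ Set.uIcc (0 : ℝ) 1, HasDerivAt
      (fun r : ℝ => (r / (1 + r * c)) ^ (b + 1) / (b + 1)) (r ^ b * ((1 + r * c) ^ (b + 2))⁻¹) r := by
    intro r hr
    have h1 : HasDerivAt (fun r : ℝ => 1 + r * c) c r := by
      simpa using ((hasDerivAt_id r).mul_const c).const_add 1
    have h2 := (((hasDerivAt_id r).div h1 (hpos r hr).ne').pow (b + 1)).div_const ((b : ℝ) + 1)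
    refine h2.congr_deriv ?_
    have := (hpos r hr).ne'
    have hb : (b : ℝ) + 1 ≠ 0 := by positivity
    simp only [id, Pi.div_apply, Nat.add_sub_cancel, div_pow]
    push_cast
    field_simp
    ring
  rw [intervalIntegral.integral_eq_sub_of_hasDerivAt h]
  · have : (1 + c) ≠ 0 := by linarith
    have hb : (b : ℝ) + 1 ≠ 0 := by positivity
    simp
    field_simp
  · refine ContinuousOn.intervalIntegrable ?_
    refine (continuous_pow b).continuousOn.mul (ContinuousOn.inv₀ (by fun_prop) fun r hr => ?_)
    exact pow_ne_zero _ (hpos r hr).ne'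

/-- The phase has modulus one and p is bounded on [0, 1]; Schwartz decay of order b + 2 at rξ then
reduces the bound to the explicit integral with c = ‖ξ‖. -/
theorem exists_norm_oscAverage_le (hp : ContDiff ℝ ∞ p) (b : ℕ) (ψ : SchwartzMap (Euc n) ℂ) :
    ∃ C, 0 ≤ C ∧ ∀ x ξ, ‖oscAverage p σ b ψ x ξ‖ ≤ C * ((1 + ‖ξ‖) ^ (b + 1))⁻¹ := by
  obtain ⟨P, hP⟩ := (isCompact_Icc (a := (0 : ℝ)) (b := 1)).exists_bound_of_continuousOn
    hp.continuous.continuousOn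
  obtain ⟨K, hK⟩ : ∃ K : ℝ, ∀ η, ‖ψ η‖ ≤ K * ((1 + ‖η‖) ^ (b + 2))⁻¹ := by
    refine ⟨2 ^ (b + 2) * ((Finset.Iic (b + 2, 0)).sup
      (fun m => SchwartzMap.seminorm ℝ m.1 m.2)) ψ, fun η => ?_⟩
    have h := SchwartzMap.one_add_le_sup_seminorm_apply (𝕜 := ℝ) (m := (b + 2, 0)) le_rfl le_rfl ψ η
    rw [norm_iteratedFDeriv_zero] at h
    rw [← div_eq_mul_inv, le_div_iff₀' (by positivity)]
    exact h
  have hP0 : 0 ≤ P := (norm_nonneg _).trans (hP 0 (by simp))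
  have hK0 : 0 ≤ K := by simpa using (norm_nonneg _).trans (hK 0)
  refine ⟨P * K, by positivity, fun x ξ => ?_⟩
  have hint : IntervalIntegrable (fun r : ℝ => P * K * (r ^ b * ((1 + r * ‖ξ‖) ^ (b + 2))⁻¹))
      volume 0 1 := by
    refine ContinuousOn.intervalIntegrable (continuousOn_const.mul ((continuous_pow b).continuousOn.mul
      (ContinuousOn.inv₀ (by fun_prop) fun r hr => ?_)))
    rw [Set.uIcc_of_le zero_le_one] at hr
    have := mul_nonneg hr.1 (norm_nonneg ξ)
    exact pow_ne_zero _ (by linarith)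
  calc ‖oscAverage p σ b ψ x ξ‖
      ≤ ∫ r in (0 : ℝ)..1, P * K * (r ^ b * ((1 + r * ‖ξ‖) ^ (b + 2))⁻¹) := by
        refine intervalIntegral.norm_integral_le_of_norm_le zero_le_one (.of_forall fun r hr => ?_)
          hint
        have h1 := hP r ⟨hr.1.le, hr.2⟩
        have h2 := hK (r • ξ)
        rw [norm_smul, Real.norm_of_nonneg hr.1.le] at h2
        rw [norm_mul, norm_mul, norm_mul, norm_pow, mul_comm Complex.I,
          Complex.norm_exp_ofReal_mul_I, Complex.norm_real, Real.norm_of_nonneg hr.1.le, one_mul]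
        calc r ^ b * ‖p r‖ * ‖ψ (r • ξ)‖ ≤ r ^ b * P * (K * ((1 + r * ‖ξ‖) ^ (b + 2))⁻¹) := by
              have := hr.1.le
              gcongr
          _ = _ := by ring
    _ = P * K * (((b : ℝ) + 1) * (1 + ‖ξ‖) ^ (b + 1))⁻¹ := by
        rw [intervalIntegral.integral_const_mul,
          integral_pow_mul_inv_one_add_mul_pow b (norm_nonneg ξ)]
    _ ≤ P * K * ((1 + ‖ξ‖) ^ (b + 1))⁻¹ := by
        gcongr
        have : 1 ≤ (b : ℝ) + 1 := by simp
        exact le_mul_of_one_le_left (by positivity) this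

-- A class of symbols stable under differentiation.

attribute [local irreducible] oscAverage

/-- Finite sums of oscillatory averages with weight `rᵇ`, with coefficients smooth in `x`. -/
inductive OscSum (p : ℝ → ℂ) (σ : ℝ) (b : ℕ) : (Euc n → Euc n → ℂ) → Prop
  | term (q : Euc n → ℂ) (ψ : SchwartzMap (Euc n) ℂ) (hq : ContDiff ℝ ∞ q) :
      OscSum p σ b (fun x ξ => q x * oscAverage p σ b ψ x ξ)
  | add (f g : Euc n → Euc n → ℂ) (hf : OscSum p σ b f) (hg : OscSum p σ b g) :
      OscSum p σ b (fun x ξ => f x ξ + g x ξ)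

namespace OscSum

variable {b : ℕ} {f : Euc n → Euc n → ℂ}

theorem contDiff (hp : ContDiff ℝ ∞ p) (hf : OscSum p σ b f) :
    ContDiff ℝ ∞ (fun q : Euc n × Euc n => f q.1 q.2) := by
  induction hf with
  | term q ψ hq => exact (hq.comp contDiff_fst).mul (contDiff_oscAverage hp b ψ)
  | add f g _ _ hf hg => exact hf.add hg

theorem contDiff_right (hp : ContDiff ℝ ∞ p) (hf : OscSum p σ b f) (x : Euc n) :
    ContDiff ℝ ∞ (f x) :=
  (hf.contDiff hp).comp (contDiff_prodMk_right x)

theorem contDiff_left (hp : ContDiff ℝ ∞ p) (hf : OscSum p σ b f) (ξ : Euc n) :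
    ContDiff ℝ ∞ (fun x => f x ξ) :=
  (hf.contDiff hp).comp (contDiff_prodMk_left ξ)

theorem const_mul (hf : OscSum p σ b f) (c : ℂ) : OscSum p σ b (fun x ξ => c * f x ξ) := by
  induction hf with
  | term q ψ hq => simpa only [mul_assoc] using term _ ψ (contDiff_const.mul hq)
  | add f g _ _ hf hg => simpa only [mul_add] using add _ _ hf hg

theorem zero : OscSum p σ b (fun _ _ : Euc n => 0) := by
  simpa using term (p := p) (σ := σ) (b := b) (fun _ : Euc n => 0) 0 contDiff_const

theorem sum {ι : Type*} (s : Finset ι) {f : ι → Euc n → Euc n → ℂ}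
    (hf : ∀ i ∈ s, OscSum p σ b (f i)) : OscSum p σ b (fun x ξ => ∑ i ∈ s, f i x ξ) := by
  classical
  induction s using Finset.induction_on with
  | empty => simpa using zero
  | insert i s hi ih =>
    simp only [Finset.sum_insert hi]
    exact add _ _ (hf i (by simp)) (ih fun k hk => hf k (by simp [hk]))

theorem partialDeriv_right (hp : ContDiff ℝ ∞ p) (hf : OscSum p σ b f) (j : Fin n) :
    OscSum p σ (b + 1) (fun x => partialDeriv j (f x)) := by
  induction hf with
  | term q ψ hq =>
    have h : (fun x => partialDeriv j (fun ξ => q x * oscAverage p σ b ψ x ξ))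
        = fun x ξ => (q x * (Complex.I * σ * x j)) * oscAverage p σ (b + 1) ψ x ξ
          + q x * oscAverage p σ (b + 1)
            (LineDeriv.lineDerivOp (EuclideanSpace.single j (1 : ℝ)) ψ) x ξ := by
      funext x ξ
      have hd : ContDiff ℝ ∞ (oscAverage p σ b ψ x) :=
        (contDiff_oscAverage (σ := σ) hp b ψ).comp
          (g := fun q : Euc n × Euc n => oscAverage p σ b ψ q.1 q.2) (contDiff_prodMk_right x)
      rw [partialDeriv_const_mul (hd.differentiable (by simp) ξ),
        partialDeriv_oscAverage_right hp]
      ring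
    rw [h]
    refine add _ _ (term _ _ (hq.mul (contDiff_const.mul ?_))) (term _ _ hq)
    exact (Complex.ofRealCLM.comp (EuclideanSpace.proj j)).contDiff
  | add f g hf hg ihf ihg =>
    have h : (fun x => partialDeriv j (fun ξ => f x ξ + g x ξ))
        = fun x ξ => partialDeriv j (f x) ξ + partialDeriv j (g x) ξ := by
      funext x ξ
      exact partialDeriv_add ((hf.contDiff_right hp x).differentiable (by simp) ξ)
        ((hg.contDiff_right hp x).differentiable (by simp) ξ) j
    rw [h]
    exact add _ _ ihf ihg

theorem partialDeriv_left (hp : ContDiff ℝ ∞ p) (hf : OscSum p σ b f) (j : Fin n) :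
    OscSum p σ b (fun x ξ => partialDeriv j (fun x' => f x' ξ) x) := by
  induction hf with
  | term q ψ hq =>
    have h : (fun x ξ => partialDeriv j (fun x' => q x' * oscAverage p σ b ψ x' ξ) x)
        = fun x ξ => (q x * (Complex.I * σ)) * oscAverage p σ b (SchwartzMap.smulLeftCLM ℂ
          (fun η : Euc n => ((η j : ℝ) : ℂ)) ψ) x ξ
          + partialDeriv j q x * oscAverage p σ b ψ x ξ := by
      funext x ξ
      have hd : ContDiff ℝ ∞ (fun x => oscAverage p σ b ψ x ξ) :=
        (contDiff_oscAverage (σ := σ) hp b ψ).comp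
          (g := fun q : Euc n × Euc n => oscAverage p σ b ψ q.1 q.2) (contDiff_prodMk_left ξ)
      rw [partialDeriv_mul (hq.differentiable (by simp) x) (hd.differentiable (by simp) x),
        partialDeriv_oscAverage_left hp]
      ring
    rw [h]
    exact add _ _ (term _ _ (hq.mul contDiff_const)) (term _ _ (contDiff_partialDeriv hq j))
  | add f g hf hg ihf ihg =>
    have h : (fun x ξ => partialDeriv j (fun x' => f x' ξ + g x' ξ) x)
        = fun x ξ => partialDeriv j (fun x' => f x' ξ) x + partialDeriv j (fun x' => g x' ξ) x := by
      funext x ξ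
      exact partialDeriv_add ((hf.contDiff_left hp ξ).differentiable (by simp) x)
        ((hg.contDiff_left hp ξ).differentiable (by simp) x) j
    rw [h]
    exact add _ _ ihf ihg

theorem iterate_partialDeriv_right (hp : ContDiff ℝ ∞ p) (hf : OscSum p σ b f) (j : Fin n)
    (k : ℕ) : OscSum p σ (b + k) (fun x => (partialDeriv j)^[k] (f x)) := by
  induction k with
  | zero => exact hf
  | succ k ih =>
    simp only [Function.iterate_succ_apply']
    exact ih.partialDeriv_right hp j

theorem iterate_partialDeriv_left (hp : ContDiff ℝ ∞ p) (hf : OscSum p σ b f) (j : Fin n)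
    (k : ℕ) : OscSum p σ b (fun x ξ => (partialDeriv j)^[k] (fun x' => f x' ξ) x) := by
  induction k with
  | zero => exact hf
  | succ k ih =>
    simp only [Function.iterate_succ_apply']
    exact ih.partialDeriv_left hp j

theorem multiDeriv_right (hp : ContDiff ℝ ∞ p) (hf : OscSum p σ b f) (β : Fin n → ℕ) :
    OscSum p σ (b + ∑ j, β j) (fun x => multiDeriv β (f x)) := by
  have h : ∀ l : List (Fin n), OscSum p σ (b + (l.map β).sum)
      (fun x => l.foldr (fun j g => (partialDeriv j)^[β j] g) (f x)) := by
    intro l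
    induction l with
    | nil => exact hf
    | cons j l ih =>
      have := ih.iterate_partialDeriv_right hp j (β j)
      simpa [add_assoc, add_comm, add_left_comm] using this
  have hs : ((List.finRange n).map β).sum = ∑ j, β j := by
    rw [← List.ofFn_eq_map, List.sum_ofFn]
  exact hs ▸ h (List.finRange n)

theorem multiDeriv_left (hp : ContDiff ℝ ∞ p) (hf : OscSum p σ b f) (α : Fin n → ℕ) :
    OscSum p σ b (fun x ξ => multiDeriv α (fun x' => f x' ξ) x) := by
  have h : ∀ l : List (Fin n), OscSum p σ b
      (fun x ξ => l.foldr (fun j g => (partialDeriv j)^[α j] g) (fun x' => f x' ξ) x) := by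
    intro l
    induction l with
    | nil => exact hf
    | cons j l ih => exact ih.iterate_partialDeriv_left hp j (α j)
  exact h _

theorem exists_norm_le (hp : ContDiff ℝ ∞ p) (hf : OscSum p σ b f) {M : Set (Euc n)}
    (hM : IsCompact M) : ∃ C, ∀ x ∈ M, ∀ ξ, ‖f x ξ‖ ≤ C * ((1 + ‖ξ‖) ^ (b + 1))⁻¹ := by
  induction hf with
  | term q ψ hq =>
    obtain ⟨C, hC⟩ := hM.exists_bound_of_continuousOn hq.continuous.continuousOn
    obtain ⟨K, hK0, hK⟩ := exists_norm_oscAverage_le (σ := σ) hp b ψ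
    refine ⟨C * K, fun x hx ξ => ?_⟩
    rw [norm_mul, mul_assoc]
    exact mul_le_mul (hC x hx) (hK x ξ) (norm_nonneg _) ((norm_nonneg _).trans (hC x hx))
  | add f g _ _ hf hg =>
    obtain ⟨C, hC⟩ := hf
    obtain ⟨K, hK⟩ := hg
    refine ⟨C + K, fun x hx ξ => (norm_add_le _ _).trans ?_⟩
    rw [add_mul]
    exact add_le_add (hC x hx ξ) (hK x hx ξ)

/-- Starting from weight 0, |β| derivatives in ξ give weight |β| and the x-derivatives leave it
there, so the decay exponent is -(|β| + 1). -/
theorem isSymbol (hp : ContDiff ℝ ∞ p) (hf : OscSum p σ 0 f) : IsSymbol (-1) f := by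
  refine ⟨hf.contDiff hp, fun M hM α β => ?_⟩
  obtain ⟨C, hC⟩ := ((hf.multiDeriv_right hp β).multiDeriv_left hp α).exists_norm_le hp hM
  refine ⟨C, fun x hx ξ => (hC x hx ξ).trans_eq ?_⟩
  congr 1
  have h : (0 : ℝ) ≤ 1 + ‖ξ‖ := by positivity
  rw [← Real.rpow_natCast, ← Real.rpow_neg h]
  congr 1
  push_cast
  ring

end OscSum

end

/-! ### Fourier inversion and quantization of dilation averages. -/

section
variable {n : ℕ} {F : Type*} [NormedAddCommGroup F] [NormedSpace ℂ F]

open FourierTransform in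
theorem exists_schwartzMap_eq_integral_cexp {U : Euc n → F} (hU : ContDiff ℝ ∞ U)
    (hUs : HasCompactSupport U) {σ : ℝ} (hσ : σ ≠ 0) :
    ∃ S : SchwartzMap (Euc n) F, ∀ ξ, S ξ
      = ∫ y, Complex.exp (-(Complex.I * ((σ * ⟪ξ, y⟫ : ℝ) : ℂ))) • U y := by
  have hc : σ * (2 * Real.pi)⁻¹ ≠ 0 := mul_ne_zero hσ (by positivity)
  -- Mathlib's transform uses e^{-2πi⟨v, ξ⟩}; evaluating it at (σ/2π)ξ gives the required phase.
  refine ⟨SchwartzMap.compCLMOfContinuousLinearEquiv ℂ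
    (ContinuousLinearEquiv.smulLeft (R₁ := ℝ) (M₁ := Euc n) (Units.mk0 _ hc))
    (𝓕 (hUs.toSchwartzMap hU)), fun ξ => ?_⟩
  rw [SchwartzMap.compCLMOfContinuousLinearEquiv_apply, Function.comp_apply,
    SchwartzMap.fourier_coe, Real.fourier_eq']
  congr 1
  funext y
  have h1 : (ContinuousLinearEquiv.smulLeft (R₁ := ℝ) (M₁ := Euc n) (Units.mk0 _ hc)) ξ
      = (σ * (2 * Real.pi)⁻¹) • ξ := rfl
  have h2 : (hUs.toSchwartzMap hU) y = U y := rfl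
  rw [h1, h2, inner_smul_right, real_inner_comm]
  congr 2
  have : (Real.pi : ℂ) ≠ 0 := by exact_mod_cast Real.pi_ne_zero
  push_cast
  field_simp

open FourierTransform in
/-- Fourier inversion with angular frequencies. -/
theorem eq_integral_cexp_smul_integral_cexp [CompleteSpace F] {U : Euc n → F}
    (hU : ContDiff ℝ ∞ U) (hUs : HasCompactSupport U) (y : Euc n) :
    U y = ((2 * Real.pi) ^ n)⁻¹ • ∫ ξ : Euc n, Complex.exp (Complex.I * ((⟪ξ, y⟫ : ℝ) : ℂ)) •
      ∫ v, Complex.exp (-(Complex.I * ((⟪ξ, v⟫ : ℝ) : ℂ))) • U v := by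
  have h1 : 𝓕⁻ (𝓕 U) y = U y := by
    have h := congrArg (fun S : SchwartzMap (Euc n) F => S y)
      (fourierInv_fourier_eq (F := SchwartzMap (Euc n) F) (hUs.toSchwartzMap hU))
    simp only [SchwartzMap.fourierInv_coe, SchwartzMap.fourier_coe] at h
    exact h
  have hpi : (0 : ℝ) < 2 * Real.pi := by positivity
  rw [← h1, Real.fourierInv_eq']
  -- The dilation ξ ↦ 2πξ converts the frequencies and yields the constant (2π)^(-n).
  have h2 := Measure.integral_comp_smul (volume : Measure (Euc n))
    (fun ξ : Euc n => Complex.exp (Complex.I * ((⟪ξ, y⟫ : ℝ) : ℂ)) •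
      ∫ v, Complex.exp (-(Complex.I * ((⟪ξ, v⟫ : ℝ) : ℂ))) • U v) (2 * Real.pi)
  rw [finrank_euclideanSpace_fin, abs_of_pos (by positivity)] at h2
  rw [← h2]
  congr 1
  funext ξ
  rw [Real.fourier_eq', inner_smul_left]
  congr 1
  · congr 1
    simp
    ring
  · congr 1
    funext v
    rw [inner_smul_left, real_inner_comm]
    congr 2
    simp
    ring

theorem norm_cexp_I_mul_ofReal (t : ℝ) : ‖Complex.exp (Complex.I * (t : ℂ))‖ = 1 := by
  rw [mul_comm, Complex.norm_exp_ofReal_mul_I]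

theorem norm_cexp_neg_I_mul_ofReal (t : ℝ) : ‖Complex.exp (-(Complex.I * (t : ℂ)))‖ = 1 := by
  rw [← norm_cexp_I_mul_ofReal (-t)]
  congr 2
  push_cast
  ring

/-- The measure `dr dw` on `(0, 1] × ℝⁿ`. -/
noncomputable abbrev radialMeasure (n : ℕ) : Measure (ℝ × Euc n) :=
  (volume.restrict (Set.Ioc (0 : ℝ) 1)).prod volume

/-- If `φ` is integrable on `(0, 1] × ℝⁿ`, the averaging operator `∫ φ(r, w) U(x - r w)` is the
quantization of the symbol `∫ φ(r, w) e^{-ir⟨ξ, w⟩}`. -/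
theorem integral_smul_comp_sub_smul_eq [CompleteSpace F] {φ : ℝ × Euc n → ℂ}
    (hφ : Integrable φ (radialMeasure n)) {U : Euc n → F} (hU : ContDiff ℝ ∞ U)
    (hUs : HasCompactSupport U) (x : Euc n) :
    Integrable (fun ξ : Euc n => Complex.exp (Complex.I * ((⟪ξ, x⟫ : ℝ) : ℂ)) •
      (∫ q, φ q * Complex.exp (-(Complex.I * ((⟪ξ, q.1 • q.2⟫ : ℝ) : ℂ))) ∂(radialMeasure n)) •
        ∫ v, Complex.exp (-(Complex.I * ((⟪ξ, v⟫ : ℝ) : ℂ))) • U v) ∧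
    ∫ q, φ q • U (x - q.1 • q.2) ∂(radialMeasure n) = ((2 * Real.pi) ^ n)⁻¹ •
      ∫ ξ : Euc n, Complex.exp (Complex.I * ((⟪ξ, x⟫ : ℝ) : ℂ)) •
      (∫ q, φ q * Complex.exp (-(Complex.I * ((⟪ξ, q.1 • q.2⟫ : ℝ) : ℂ))) ∂(radialMeasure n)) •
        ∫ v, Complex.exp (-(Complex.I * ((⟪ξ, v⟫ : ℝ) : ℂ))) • U v := by
  obtain ⟨S, hS⟩ := exists_schwartzMap_eq_integral_cexp hU hUs one_ne_zero
  simp only [one_mul] at hS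
  simp only [← hS]
  -- Absolute integrability in (q, ξ) jointly, needed for Fubini: φ is integrable, the transform of
  -- U is Schwartz, and the exponential has modulus one.
  have hK : Integrable (fun z : (ℝ × Euc n) × Euc n =>
      Complex.exp (Complex.I * ((⟪z.2, x - z.1.1 • z.1.2⟫ : ℝ) : ℂ)) • (φ z.1 • S z.2))
      ((radialMeasure n).prod volume) := by
    have h1 : Integrable (fun z : (ℝ × Euc n) × Euc n => φ z.1 • S z.2)
        ((radialMeasure n).prod volume) := hφ.smul_prod S.integrable
    refine h1.bdd_smul (𝕜 := ℂ) 1 (φ := fun z : (ℝ × Euc n) × Euc n =>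
      Complex.exp (Complex.I * ((⟪z.2, x - z.1.1 • z.1.2⟫ : ℝ) : ℂ))) ?_ (.of_forall fun z => ?_)
    · exact Continuous.aestronglyMeasurable (by fun_prop)
    · exact (norm_cexp_I_mul_ofReal _).le
  have hinner : ∀ ξ : Euc n, (∫ q, Complex.exp (Complex.I * ((⟪ξ, x - q.1 • q.2⟫ : ℝ) : ℂ)) •
      (φ q • S ξ) ∂(radialMeasure n)) = Complex.exp (Complex.I * ((⟪ξ, x⟫ : ℝ) : ℂ)) •
      (∫ q, φ q * Complex.exp (-(Complex.I * ((⟪ξ, q.1 • q.2⟫ : ℝ) : ℂ))) ∂(radialMeasure n)) •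
        S ξ := by
    intro ξ
    rw [← integral_smul_const, ← integral_smul]
    congr 1
    funext q
    rw [inner_sub_right, smul_smul, smul_smul, mul_left_comm, ← Complex.exp_add, mul_comm (φ q)]
    congr 3
    push_cast
    ring
  have hint := hK.integral_prod_right
  simp only [hinner] at hint
  refine ⟨hint, ?_⟩
  have hswap := integral_integral_swap (f := fun (q : ℝ × Euc n) (ξ : Euc n) =>
    Complex.exp (Complex.I * ((⟪ξ, x - q.1 • q.2⟫ : ℝ) : ℂ)) • (φ q • S ξ)) hK
  simp only [hinner] at hswap
  rw [← hswap, ← integral_smul]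
  congr 1
  funext q
  rw [eq_integral_cexp_smul_integral_cexp hU hUs (x - q.1 • q.2)]
  simp only [← hS]
  rw [smul_comm, ← integral_smul]
  congr 2
  funext ξ
  rw [smul_comm]

theorem integral_comp_add_smul_of_sq_eq_one {G : Type*} [NormedAddCommGroup G] [NormedSpace ℝ G]
    {σ : ℝ} (hσ : σ ^ 2 = 1) (g : Euc n → G) (x : Euc n) :
    ∫ w, g (x + σ • w) = ∫ v, g v := by
  have h := Measure.integral_comp_smul (volume : Measure (Euc n)) (fun w => g (x + w)) σ
  have hσ₁ : |σ| = 1 := by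
    rw [← sq_abs] at hσ
    exact (pow_eq_one_iff_of_nonneg (abs_nonneg σ) two_ne_zero).1 hσ
  have hσ' : |(σ ^ Module.finrank ℝ (Euc n))⁻¹| = 1 := by
    rw [abs_inv, abs_pow, hσ₁, one_pow, inv_one]
  rw [h, hσ', one_smul, integral_add_left_eq_self]

/-! ### The radial symbol. -/

variable {θ : Euc n → ℝ} {p : ℝ → ℝ} {σ : ℝ}

theorem integrable_radial_weight (hp : Continuous p) (hθ : Continuous θ)
    (hθs : HasCompactSupport θ) (hσ : σ ≠ 0) (x : Euc n) (j : Fin n) :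
    Integrable (fun q : ℝ × Euc n => ((p q.1 * (θ (x + σ • q.2) * q.2 j) : ℝ) : ℂ))
      (radialMeasure n) := by
  have h1 : Integrable p (volume.restrict (Set.Ioc (0 : ℝ) 1)) :=
    (hp.continuousOn.integrableOn_compact isCompact_Icc).mono_set Set.Ioc_subset_Icc_self
  have hs : HasCompactSupport (fun w : Euc n => θ (x + σ • w)) :=
    hθs.comp_homeomorph ((Homeomorph.smulOfNeZero σ hσ).trans (Homeomorph.addLeft x))
  have h2 : Integrable (fun w : Euc n => θ (x + σ • w) * w j) :=
    Continuous.integrable_of_hasCompactSupport (by fun_prop) hs.mul_right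
  exact (h1.mul_prod h2).ofReal

/-- The symbol of the `j`-th component of the averaging operator. -/
noncomputable def radialSymbol (θ : Euc n → ℝ) (p : ℝ → ℝ) (σ : ℝ) (j : Fin n) (x ξ : Euc n) : ℂ :=
  ∫ q, ((p q.1 * (θ (x + σ • q.2) * q.2 j) : ℝ) : ℂ) *
    Complex.exp (-(Complex.I * ((⟪ξ, q.1 • q.2⟫ : ℝ) : ℂ))) ∂(radialMeasure n)

/-- Since σ² = 1, substituting v = x + σw gives w = σ(v - x). The w-integral becomes a phase in x
times transforms of θ(v)v_j and θ(v), the latter with coefficient -x_j. Evaluating at rξ and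
integrating over r gives two oscillatory averages of weight 0. -/
theorem oscSum_radialSymbol (hp : ContDiff ℝ ∞ p) (hθ : ContDiff ℝ ∞ θ)
    (hθs : HasCompactSupport θ) (hσ : σ ^ 2 = 1) (j : Fin n) :
    OscSum (fun r => (p r : ℂ)) σ 0 (radialSymbol θ p σ j) := by
  have hσ0 : σ ≠ 0 := by rintro rfl; norm_num at hσ
  have hθc : ContDiff ℝ ∞ (fun v => (θ v : ℂ)) := Complex.ofRealCLM.contDiff.comp hθ
  have hθcs : HasCompactSupport (fun v => (θ v : ℂ)) :=
    hθs.comp_left (g := fun t : ℝ => (t : ℂ)) (by simp)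
  have hcoord : ContDiff ℝ ∞ (fun v : Euc n => ((v j : ℝ) : ℂ)) :=
    (Complex.ofRealCLM.comp (EuclideanSpace.proj j)).contDiff
  obtain ⟨ψ₀, hψ₀⟩ := exists_schwartzMap_eq_integral_cexp hθc hθcs hσ0
  obtain ⟨ψ₁, hψ₁⟩ := exists_schwartzMap_eq_integral_cexp (hθc.mul hcoord) hθcs.mul_right hσ0
  have hpc : ContDiff ℝ ∞ (fun r => (p r : ℂ)) := Complex.ofRealCLM.contDiff.comp hp
  have hexp : ∀ ξ : Euc n, Continuous fun v : Euc n =>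
      Complex.exp (-(Complex.I * ((σ * ⟪ξ, v⟫ : ℝ) : ℂ))) := fun ξ => by fun_prop
  have hint₁ : ∀ ξ : Euc n, Integrable fun v : Euc n =>
      Complex.exp (-(Complex.I * ((σ * ⟪ξ, v⟫ : ℝ) : ℂ))) • ((θ v : ℂ) * (v j : ℂ)) := fun ξ =>
    ((hexp ξ).smul (hθc.continuous.mul hcoord.continuous)).integrable_of_hasCompactSupport
      hθcs.mul_right.smul_left
  have hint₀ : ∀ ξ : Euc n, Integrable fun v : Euc n =>
      Complex.exp (-(Complex.I * ((σ * ⟪ξ, v⟫ : ℝ) : ℂ))) • (θ v : ℂ) := fun ξ =>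
    ((hexp ξ).smul hθc.continuous).integrable_of_hasCompactSupport hθcs.smul_left
  have hfiber : ∀ x ξ : Euc n, ∫ w : Euc n, ((θ (x + σ • w) * w j : ℝ) : ℂ) *
      Complex.exp (-(Complex.I * ((⟪ξ, w⟫ : ℝ) : ℂ)))
      = σ * (Complex.exp (Complex.I * ((σ * ⟪ξ, x⟫ : ℝ) : ℂ)) * (ψ₁ ξ - x j * ψ₀ ξ)) := by
    intro x ξ
    have h := integral_comp_add_smul_of_sq_eq_one hσ (fun v : Euc n =>
      ((θ v * (σ * (v j - x j)) : ℝ) : ℂ) *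
      Complex.exp (-(Complex.I * ((σ * ⟪ξ, v - x⟫ : ℝ) : ℂ)))) x
    have hσσ : σ * σ = 1 := by rw [← sq, hσ]
    calc _ = ∫ w : Euc n, (fun v : Euc n => ((θ v * (σ * (v j - x j)) : ℝ) : ℂ) *
          Complex.exp (-(Complex.I * ((σ * ⟪ξ, v - x⟫ : ℝ) : ℂ)))) (x + σ • w) := by
          congr 1
          funext w
          simp only [add_sub_cancel_left, inner_smul_right, PiLp.add_apply, PiLp.smul_apply,
            smul_eq_mul, ← mul_assoc, hσσ, one_mul]
      _ = _ := h
      _ = ∫ v : Euc n, (σ * Complex.exp (Complex.I * ((σ * ⟪ξ, x⟫ : ℝ) : ℂ))) *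
          (Complex.exp (-(Complex.I * ((σ * ⟪ξ, v⟫ : ℝ) : ℂ))) • ((θ v : ℂ) * (v j : ℂ)) -
            x j * Complex.exp (-(Complex.I * ((σ * ⟪ξ, v⟫ : ℝ) : ℂ))) • (θ v : ℂ)) := by
          congr 1
          funext v
          have he : Complex.exp (-(Complex.I * ((σ * ⟪ξ, v - x⟫ : ℝ) : ℂ)))
              = Complex.exp (Complex.I * ((σ * ⟪ξ, x⟫ : ℝ) : ℂ)) *
                Complex.exp (-(Complex.I * ((σ * ⟪ξ, v⟫ : ℝ) : ℂ))) := by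
            rw [← Complex.exp_add, inner_sub_right]
            congr 1
            push_cast
            ring
          rw [he]
          simp only [smul_eq_mul]
          push_cast
          ring
      _ = _ := by
          rw [integral_const_mul, integral_sub (hint₁ ξ) ((hint₀ ξ).const_mul _),
            integral_const_mul, hψ₀, hψ₁, mul_assoc]
  have h : radialSymbol θ p σ j = fun x ξ =>
      (σ : ℂ) * oscAverage (fun r => (p r : ℂ)) σ 0 ψ₁ x ξ
      + (-(σ * x j)) * oscAverage (fun r => (p r : ℂ)) σ 0 ψ₀ x ξ := by
    funext x ξ
    have hi : Integrable (fun q : ℝ × Euc n => ((p q.1 * (θ (x + σ • q.2) * q.2 j) : ℝ) : ℂ) *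
        Complex.exp (-(Complex.I * ((⟪ξ, q.1 • q.2⟫ : ℝ) : ℂ)))) (radialMeasure n) := by
      simp only [mul_comm _ (Complex.exp _)]
      refine (integrable_radial_weight hp.continuous hθ.continuous hθs hσ0 x j).bdd_mul (c := 1)
        (Continuous.aestronglyMeasurable (by fun_prop))
        (.of_forall fun q => (norm_cexp_neg_I_mul_ofReal _).le)
    rw [radialSymbol, integral_prod _ hi, ← intervalIntegral.integral_of_le zero_le_one]
    unfold oscAverage
    rw [← intervalIntegral.integral_const_mul, ← intervalIntegral.integral_const_mul,
      ← intervalIntegral.integral_add ((intervalIntegrable_oscAverage hpc _ _ _ _).const_mul _)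
      ((intervalIntegrable_oscAverage hpc _ _ _ _).const_mul _)]
    refine intervalIntegral.integral_congr fun r _ => ?_
    have h1 : ∀ w : Euc n, ((p r * (θ (x + σ • w) * w j) : ℝ) : ℂ) *
        Complex.exp (-(Complex.I * ((⟪ξ, r • w⟫ : ℝ) : ℂ)))
        = (p r : ℂ) * (((θ (x + σ • w) * w j : ℝ) : ℂ) *
        Complex.exp (-(Complex.I * ((⟪r • ξ, w⟫ : ℝ) : ℂ)))) := by
      intro w
      rw [inner_smul_right, real_inner_smul_left]
      push_cast
      ring
    simp only [h1]
    rw [integral_const_mul, hfiber, real_inner_smul_left, ← mul_assoc σ r]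
    ring
  rw [h]
  exact .add _ _ (.term _ _ contDiff_const) (.term _ _ ((contDiff_const.mul hcoord).neg))

/-! ### The radial kernel in dilation coordinates. -/

/-- The radial kernel `∫₁^∞ sⁿ⁻¹ p(1/s) θ(x + σ s z) ds`. -/
noncomputable def radialKernel (θ : Euc n → ℝ) (p : ℝ → ℝ) (σ : ℝ) (x z : Euc n) : ℝ :=
  ∫ s in Set.Ioi (1 : ℝ), s ^ (n - 1) * p s⁻¹ * θ (x + (σ * s) • z)

/-- Substitute s = 1/r: the power r^(1-n) and the Jacobian r^(-2) combine to r^(-(n+1)). -/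
theorem radialKernel_eq_integral_Ioc (hn : 1 ≤ n) (x z : Euc n) :
    radialKernel θ p σ x z
      = ∫ r in Set.Ioc (0 : ℝ) 1, (r ^ (n + 1))⁻¹ * p r * θ (x + σ • r⁻¹ • z) := by
  have himg : (fun r : ℝ => r⁻¹) '' Set.Ioo 0 1 = Set.Ioi 1 := by
    ext s
    constructor
    · rintro ⟨r, hr, rfl⟩
      exact (one_lt_inv₀ hr.1).2 hr.2
    · intro hs
      have hs' : (1 : ℝ) < s := hs
      exact ⟨s⁻¹, ⟨inv_pos.2 (by linarith), inv_lt_one_of_one_lt₀ hs'⟩, inv_inv s⟩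
  rw [radialKernel, ← himg, integral_image_eq_integral_abs_deriv_smul measurableSet_Ioo
    (f' := fun r => -(r ^ 2)⁻¹) (fun r hr => (hasDerivAt_inv hr.1.ne').hasDerivWithinAt)
    inv_injective.injOn, integral_Ioc_eq_integral_Ioo]
  refine setIntegral_congr_fun measurableSet_Ioo fun r hr => ?_
  have hr0 : r ≠ 0 := hr.1.ne'
  obtain ⟨m, rfl⟩ := Nat.exists_eq_add_of_le' hn
  simp only [abs_neg, abs_inv, abs_pow, abs_of_pos hr.1, inv_inv, smul_eq_mul, smul_smul,
    Nat.add_sub_cancel, inv_pow]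
  rw [← mul_assoc, ← mul_assoc]
  congr 2
  field_simp
  ring

theorem radial_smul_eq (U : Euc n → F) (x : Euc n) (j : Fin n) {r : ℝ} (hr : 0 < r) (z : Euc n) :
    (((r ^ (n + 1))⁻¹ * p r * θ (x + σ • r⁻¹ • z) * z j : ℝ) : ℂ) • U (x - z)
      = (((r ^ n)⁻¹ * p r : ℝ) : ℂ) • (fun w : Euc n =>
        ((θ (x + σ • w) * w j : ℝ) : ℂ) • U (x - r • w)) (r⁻¹ • z) := by
  simp only [smul_smul, mul_inv_cancel₀ hr.ne', one_smul, PiLp.smul_apply, smul_eq_mul]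
  congr 1
  norm_cast
  rw [pow_succ, mul_inv]
  ring

/-- With z = rw, the coordinate z_j lowers r^(-(n+1)) to r^(-n), which the Jacobian rⁿ cancels
exactly. -/
theorem integral_radial_smul (U : Euc n → F) (x : Euc n) (j : Fin n) {r : ℝ} (hr : 0 < r) :
    ∫ z : Euc n, (((r ^ (n + 1))⁻¹ * p r * θ (x + σ • r⁻¹ • z) * z j : ℝ) : ℂ) • U (x - z)
      = (p r : ℂ) • ∫ w : Euc n, ((θ (x + σ • w) * w j : ℝ) : ℂ) • U (x - r • w) := by
  simp only [radial_smul_eq U x j hr]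
  rw [integral_smul, Measure.integral_comp_smul volume (fun w : Euc n =>
    ((θ (x + σ • w) * w j : ℝ) : ℂ) • U (x - r • w)), finrank_euclideanSpace_fin, inv_pow, inv_inv,
    abs_of_pos (pow_pos hr n), ← Complex.coe_smul, smul_smul]
  congr 1
  have := (pow_pos hr n).ne'
  norm_cast
  field_simp

section
variable (hp : Continuous p) (hθ : Continuous θ) (hθs : HasCompactSupport θ) (hσ : σ ≠ 0)
  {U : Euc n → F} (hU : Continuous U) (hUs : HasCompactSupport U)
include hθ hθs hσ hU

theorem integrable_radial_fiber (x : Euc n) (j : Fin n) (r : ℝ) :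
    Integrable (fun w : Euc n => ((θ (x + σ • w) * w j : ℝ) : ℂ) • U (x - r • w)) := by
  have hs : HasCompactSupport (fun w : Euc n => θ (x + σ • w)) :=
    hθs.comp_homeomorph ((Homeomorph.smulOfNeZero σ hσ).trans (Homeomorph.addLeft x))
  have hs' : HasCompactSupport (fun w : Euc n => ((θ (x + σ • w) * w j : ℝ) : ℂ)) :=
    (hs.mul_right (f' := fun w : Euc n => w j)).comp_left (g := fun t : ℝ => (t : ℂ)) (by simp)
  exact Continuous.integrable_of_hasCompactSupport (by fun_prop) hs'.smul_right

include hp hUs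

/-- By Tonelli it suffices to bound the norm integral of the fibre over r. After the cancellation of
rⁿ this is at most sup|p| · sup‖U‖ · ∫|θ(x + σw) w_j| dw, uniformly for r in (0, 1]. -/
theorem integrable_radial_smul (x : Euc n) (j : Fin n) :
    Integrable (fun q : ℝ × Euc n => (((q.1 ^ (n + 1))⁻¹ * p q.1 *
      θ (x + σ • q.1⁻¹ • q.2) * q.2 j : ℝ) : ℂ) • U (x - q.2)) (radialMeasure n) := by
  have hmeas : AEStronglyMeasurable (fun q : ℝ × Euc n => (((q.1 ^ (n + 1))⁻¹ * p q.1 *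
      θ (x + σ • q.1⁻¹ • q.2) * q.2 j : ℝ) : ℂ) • U (x - q.2)) (radialMeasure n) := by
    have h1 : Measurable fun q : ℝ × Euc n => (q.1 ^ (n + 1))⁻¹ * p q.1 *
        θ (x + σ • q.1⁻¹ • q.2) * q.2 j := by
      have h2 := hp.measurable
      have h3 := hθ.measurable
      fun_prop
    exact h1.complex_ofReal.aestronglyMeasurable.smul
      (Continuous.aestronglyMeasurable (by fun_prop))
  have hpos : ∀ᵐ r ∂(volume.restrict (Set.Ioc (0 : ℝ) 1)), r ∈ Set.Ioc (0 : ℝ) 1 :=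
    ae_restrict_mem measurableSet_Ioc
  refine (integrable_prod_iff hmeas).2 ⟨?_, ?_⟩
  · filter_upwards [hpos] with r hr
    simp only [radial_smul_eq U x j hr.1]
    exact ((integrable_radial_fiber hθ hθs hσ hU x j r).comp_smul
      (inv_ne_zero hr.1.ne')).smul _
  · obtain ⟨P, hP⟩ := (isCompact_Icc (a := (0 : ℝ)) (b := 1)).exists_bound_of_continuousOn
      hp.continuousOn
    obtain ⟨K, hK⟩ := hUs.exists_bound_of_continuous hU
    have hK0 : 0 ≤ K := (norm_nonneg _).trans (hK 0)
    -- Taking U = 1 isolates the integrability of the weight θ(x + σw) w_j alone.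
    have hg := (integrable_radial_fiber (F := ℂ) (U := fun _ => 1) hθ hθs hσ continuous_const x j
      0).norm
    refine Integrable.of_bound hmeas.norm.integral_prod_right'
      (P * ((∫ w : Euc n, ‖((θ (x + σ • w) * w j : ℝ) : ℂ) • (1 : ℂ)‖) * K)) ?_
    filter_upwards [hpos] with r hr
    rw [Real.norm_of_nonneg (integral_nonneg fun _ => norm_nonneg _)]
    simp only [radial_smul_eq U x j hr.1, norm_smul (((r ^ n)⁻¹ * p r : ℝ) : ℂ)]
    rw [integral_const_mul, Measure.integral_comp_smul volume (fun w : Euc n =>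
      ‖((θ (x + σ • w) * w j : ℝ) : ℂ) • U (x - r • w)‖), finrank_euclideanSpace_fin, inv_pow,
      inv_inv, abs_of_pos (pow_pos hr.1 n), Complex.norm_real, norm_mul, norm_inv, norm_pow,
      Real.norm_of_nonneg hr.1.le, smul_eq_mul]
    have hrn := (pow_pos hr.1 n).ne'
    rw [← mul_assoc, mul_right_comm _ _ (r ^ n), inv_mul_cancel₀ hrn, one_mul]
    refine mul_le_mul (hP r ⟨hr.1.le, hr.2⟩) ?_ (integral_nonneg fun _ => norm_nonneg _)
      ((norm_nonneg _).trans (hP r ⟨hr.1.le, hr.2⟩))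
    rw [← integral_mul_const]
    refine integral_mono (integrable_radial_fiber hθ hθs hσ hU x j r).norm (hg.mul_const K)
      fun w => ?_
    simp only [norm_smul, norm_one, mul_one]
    exact mul_le_mul_of_nonneg_left (hK _) (norm_nonneg _)

/-- Integration against the radial kernel is absolutely convergent, and in polar-type coordinates
it is an average over dilations. -/
theorem integral_radialKernel_smul [CompleteSpace F] (hn : 1 ≤ n) (x : Euc n) (j : Fin n) :
    Integrable (fun z : Euc n => ((radialKernel θ p σ x z * z j : ℝ) : ℂ) • U (x - z)) ∧
    ∫ z : Euc n, ((radialKernel θ p σ x z * z j : ℝ) : ℂ) • U (x - z)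
      = ∫ q, ((p q.1 * (θ (x + σ • q.2) * q.2 j) : ℝ) : ℂ) • U (x - q.1 • q.2)
        ∂(radialMeasure n) := by
  have hint := integrable_radial_smul hp hθ hθs hσ hU hUs x j
  have hinner : ∀ z : Euc n, (∫ r in Set.Ioc (0 : ℝ) 1, (((r ^ (n + 1))⁻¹ * p r *
      θ (x + σ • r⁻¹ • z) * z j : ℝ) : ℂ) • U (x - z))
      = ((radialKernel θ p σ x z * z j : ℝ) : ℂ) • U (x - z) := by
    intro z
    rw [integral_smul_const, integral_complex_ofReal, integral_mul_const, radialKernel_eq_integral_Ioc hn]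
  have hright := hint.integral_prod_right
  simp only [hinner] at hright
  refine ⟨hright, ?_⟩
  have hswap := integral_integral_swap (f := fun (r : ℝ) (z : Euc n) => (((r ^ (n + 1))⁻¹ * p r *
      θ (x + σ • r⁻¹ • z) * z j : ℝ) : ℂ) • U (x - z)) hint
  simp only [hinner] at hswap
  have hφ : Integrable (fun q : ℝ × Euc n => ((p q.1 * (θ (x + σ • q.2) * q.2 j) : ℝ) : ℂ) •
      U (x - q.1 • q.2)) (radialMeasure n) := by
    obtain ⟨K, hK⟩ := hUs.exists_bound_of_continuous hU
    exact (integrable_radial_weight hp hθ hθs hσ x j).smul_bdd K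
      (Continuous.aestronglyMeasurable (by fun_prop)) (.of_forall fun q => hK _)
  rw [← hswap, integral_prod _ hφ]
  refine setIntegral_congr_fun measurableSet_Ioc fun r hr => ?_
  simp only
  rw [integral_radial_smul U x j hr.1, ← integral_smul]
  congr 1
  funext w
  rw [smul_smul]
  push_cast
  rfl

end

theorem integral_sum_radialKernel_smul [CompleteSpace F] (hn : 1 ≤ n) (hp : ContDiff ℝ ∞ p)
    (hθ : ContDiff ℝ ∞ θ) (hθs : HasCompactSupport θ) (hσ : σ ≠ 0) {U : Fin n → Euc n → F}
    (hU : ∀ j, ContDiff ℝ ∞ (U j)) (hUs : ∀ j, HasCompactSupport (U j)) (x : Euc n) :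
    Integrable (fun y : Euc n =>
      ∑ j, ((radialKernel θ p σ x (x - y) * (x - y) j : ℝ) : ℂ) • U j y) ∧
    ∫ y : Euc n, ∑ j, ((radialKernel θ p σ x (x - y) * (x - y) j : ℝ) : ℂ) • U j y
      = ((2 * Real.pi) ^ n)⁻¹ • ∫ ξ : Euc n, Complex.exp (Complex.I * ((⟪ξ, x⟫ : ℝ) : ℂ)) •
        ∑ j, radialSymbol θ p σ j x ξ •
          ∫ v, Complex.exp (-(Complex.I * ((⟪ξ, v⟫ : ℝ) : ℂ))) • U j v := by
  have hker := fun j => integral_radialKernel_smul hp.continuous hθ.continuous hθs hσ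
    (hU j).continuous (hUs j) hn x j
  have hquant := fun j => integral_smul_comp_sub_smul_eq
    (integrable_radial_weight hp.continuous hθ.continuous hθs hσ x j) (hU j) (hUs j) x
  have hint : Integrable fun z : Euc n =>
      ∑ j, ((radialKernel θ p σ x z * z j : ℝ) : ℂ) • U j (x - z) :=
    integrable_finsetSum _ fun j _ => (hker j).1
  have hflip := hint.comp_sub_left x
  have hflip' := integral_sub_left_eq_self (fun z : Euc n =>
      ∑ j, ((radialKernel θ p σ x z * z j : ℝ) : ℂ) • U j (x - z)) volume x
  simp only [sub_sub_cancel] at hflip hflip'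
  refine ⟨hflip, hflip'.trans ?_⟩
  rw [integral_finsetSum _ fun j _ => (hker j).1,
    Finset.sum_congr rfl fun j _ => (hker j).2.trans (hquant j).2, ← Finset.smul_sum,
    ← integral_finsetSum _ fun j _ => (hquant j).1]
  simp only [Finset.smul_sum]
  rfl

theorem integrable_sum_smul_of_hasCompactSupport {c : Fin n → Euc n → ℂ} {U : Fin n → Euc n → F}
    (hc : ∀ j, Continuous (c j)) (hU : ∀ j, Continuous (U j))
    (hUs : ∀ j, HasCompactSupport (U j)) : Integrable fun y => ∑ j, c j y • U j y :=
  integrable_finsetSum _ fun j _ =>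
    ((hc j).smul (hU j)).integrable_of_hasCompactSupport (hUs j).smul_left

theorem integrable_and_integral_fun_add {f g : Euc n → F} (hf : Integrable f) (hg : Integrable g) :
    Integrable (fun y => f y + g y) ∧ ∫ y, (f y + g y) = (∫ y, f y) + ∫ y, g y :=
  ⟨hf.add hg, integral_add hf hg⟩

theorem integral_cexp_smul_continuousLinearMap [CompleteSpace F] {G : Type*}
    [NormedAddCommGroup G] [NormedSpace ℂ G] [CompleteSpace G] (B : F →L[ℂ] G) {U : Euc n → F}
    (hU : Continuous U) (hUs : HasCompactSupport U) (ξ : Euc n) :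
    ∫ v, Complex.exp (-(Complex.I * ((⟪ξ, v⟫ : ℝ) : ℂ))) • B (U v)
      = B (∫ v, Complex.exp (-(Complex.I * ((⟪ξ, v⟫ : ℝ) : ℂ))) • U v) := by
  have hi : Integrable fun y => Complex.exp (-(Complex.I * ((⟪ξ, y⟫ : ℝ) : ℂ))) • U y :=
    Continuous.integrable_of_hasCompactSupport (Continuous.smul (by fun_prop) hU) hUs.smul_left
  rw [← B.integral_comp_comm hi]
  simp only [map_smul]

end

/-! ### Contractions in coordinates and form-valued symbols. -/

/-- Contraction with a fixed vector as a continuous linear map. -/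
noncomputable def contractCLM {n : ℕ} (a : Euc n) : (ℓ : ℕ) → Form n ℓ →L[ℂ] Form n (ℓ - 1)
  | 0 => 0
  | ℓ + 1 => LinearMap.mkContinuous
      { toFun := fun u : Form n (ℓ + 1) => u.curryLeft a
        map_add' := fun _ _ => rfl
        map_smul' := fun _ _ => rfl } ‖a‖ fun u => by
          rw [mul_comm, ← ContinuousAlternatingMap.norm_curryLeft u]
          exact u.curryLeft.le_opNorm a

theorem contractCLM_apply {n ℓ : ℕ} (a : Euc n) (u : Form n ℓ) :
    contractCLM a ℓ u = contract a u := by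
  cases ℓ <;> rfl

theorem contract_eq_sum {n ℓ : ℕ} (z : Euc n) (u : Form n ℓ) :
    contract z u = ∑ j, (z j : ℂ) • contractCLM (EuclideanSpace.single j 1) ℓ u := by
  cases ℓ with
  | zero => exact (Finset.sum_eq_zero fun j _ => smul_zero _).symm
  | succ ℓ =>
    have hz : z = ∑ j, z j • EuclideanSpace.single j (1 : ℝ) := by
      ext i
      simp [Finset.sum_apply, Pi.single_apply]
    calc contract z u = u.curryLeft z := rfl
      _ = ∑ j, z j • u.curryLeft (EuclideanSpace.single j (1 : ℝ)) := by
        conv_lhs => rw [hz]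
        rw [map_sum]
        simp only [map_smul]
      _ = _ := Finset.sum_congr rfl fun j _ => by
        rw [contractCLM_apply]
        exact ContinuousAlternatingMap.ext fun v => Complex.real_smul

theorem contract_zero {n ℓ : ℕ} (u : Form n ℓ) : contract 0 u = 0 := by
  cases ℓ with
  | zero => rfl
  | succ ℓ => exact map_zero u.curryLeft

theorem smul_contract_eq_sum {n ℓ : ℕ} (c : ℝ) (z : Euc n) (u : Form n ℓ) :
    c • contract z u
      = ∑ j, ((c * z j : ℝ) : ℂ) • contractCLM (EuclideanSpace.single j 1) ℓ u := by
  rw [contract_eq_sum, Finset.smul_sum]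
  refine Finset.sum_congr rfl fun j _ => ?_
  rw [← Complex.coe_smul, smul_smul, Complex.ofReal_mul]

section
variable {n : ℕ}

/-- The linear map on forms `∑ⱼ cⱼ eⱼ ⌟ ·`. -/
noncomputable def contractCombination (ℓ : ℕ) (c : Fin n → ℂ) : Form n ℓ →ₗ[ℂ] Form n (ℓ - 1) :=
  ∑ j, c j • (contractCLM (EuclideanSpace.single j 1) ℓ : Form n ℓ →ₗ[ℂ] Form n (ℓ - 1))

theorem contractCombination_apply {ℓ : ℕ} (c : Fin n → ℂ) (u : Form n ℓ) :
    contractCombination ℓ c u = ∑ j, c j • contractCLM (EuclideanSpace.single j 1) ℓ u := by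
  simp [contractCombination]

theorem contractCombination_apply_apply {ℓ : ℕ} (c : Fin n → ℂ) (u : Form n ℓ)
    (v : Fin (ℓ - 1) → Euc n) : contractCombination ℓ c u v
      = ∑ j, contractCLM (EuclideanSpace.single j 1) ℓ u v * c j := by
  rw [contractCombination_apply, ContinuousAlternatingMap.sum_apply]
  exact Finset.sum_congr rfl fun j _ => mul_comm _ _

variable {ℓ : ℕ} {θ : Euc n → ℝ} {p : ℝ → ℝ} {σ : ℝ}

theorem isFormSymbol_radialSymbol (hp : ContDiff ℝ ∞ p) (hθ : ContDiff ℝ ∞ θ)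
    (hθs : HasCompactSupport θ) (hσ : σ ^ 2 = 1) :
    IsFormSymbol (-1) fun x ξ => contractCombination ℓ fun j => radialSymbol θ p σ j x ξ := by
  intro w v
  simp only [contractCombination_apply_apply]
  exact OscSum.isSymbol (Complex.ofRealCLM.contDiff.comp hp)
    (OscSum.sum _ fun j _ => (oscSum_radialSymbol hp hθ hθs hσ j).const_mul _)

/-- The integral operator with kernel `radialKernel θ p σ x (x - y) (x - y) ⌟` converges absolutely
and is the quantization of its radial symbol. -/
theorem integral_radialKernel_contract (hn : 1 ≤ n) (hp : ContDiff ℝ ∞ p) (hθ : ContDiff ℝ ∞ θ)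
    (hθs : HasCompactSupport θ) (hσ : σ ≠ 0) {u : Euc n → Form n ℓ} (hu : ContDiff ℝ ∞ u)
    (hus : HasCompactSupport u) (x : Euc n) :
    Integrable (fun y => radialKernel θ p σ x (x - y) • contract (x - y) (u y)) ∧
    ∫ y, radialKernel θ p σ x (x - y) • contract (x - y) (u y)
      = quantize (fun x ξ => contractCombination ℓ fun j => radialSymbol θ p σ j x ξ) u x := by
  set B : Fin n → Form n ℓ →L[ℂ] Form n (ℓ - 1) :=
    fun j => contractCLM (EuclideanSpace.single j 1) ℓ with hB
  have hUc : ∀ j, ContDiff ℝ ∞ fun y => B j (u y) := fun j =>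
    ((B j).restrictScalars ℝ).contDiff.comp hu
  have hUs : ∀ j, HasCompactSupport fun y => B j (u y) := fun j =>
    hus.comp_left (g := B j) (map_zero _)
  have hsum := integral_sum_radialKernel_smul hn hp hθ hθs hσ hUc hUs x
  have hexpand : (fun y => radialKernel θ p σ x (x - y) • contract (x - y) (u y))
      = fun y => ∑ j, ((radialKernel θ p σ x (x - y) * (x - y) j : ℝ) : ℂ) • B j (u y) :=
    funext fun y => smul_contract_eq_sum _ _ _
  rw [hexpand]
  refine ⟨hsum.1, hsum.2.trans ?_⟩
  rw [quantize]
  congr 2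
  funext ξ
  rw [contractCombination_apply]
  congr 1
  refine Finset.sum_congr rfl fun j _ => ?_
  congr 1
  exact integral_cexp_smul_continuousLinearMap (B j) hu.continuous hus ξ

/-! ### The Poincaré and Bogovskiĭ kernels as radial kernels. -/

/-- Here (s - 1)^(ℓ-1) s^(n-ℓ) = sⁿ⁻¹ (1 - 1/s)^(ℓ-1), and swapping the arguments places θ at x -
s(x - y), so σ = -1. No smooth remainder appears. -/
theorem kernelG_swap_eq_radialKernel (hℓ : 1 ≤ ℓ) (hℓn : ℓ ≤ n) (x y : Euc n) :
    kernelG θ (n - ℓ + 1) y x = radialKernel θ (fun r => (1 - r) ^ (ℓ - 1)) (-1) x (x - y) := by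
  refine setIntegral_congr_fun measurableSet_Ioi fun s hs => ?_
  have hs0 : s ≠ 0 := (zero_lt_one.trans (show (1 : ℝ) < s from hs)).ne'
  have h1 : n - (n - ℓ + 1) = ℓ - 1 := by omega
  have h2 : n - 1 = (n - ℓ) + (ℓ - 1) := by omega
  have h3 : s - 1 = s * (1 - s⁻¹) := by field_simp
  have h4 : x + s • (y - x) = x + (-1 * s) • (x - y) := by module
  simp only [Nat.add_sub_cancel]
  rw [h1, h2, h3, h4, mul_pow, pow_add]
  ring

/-- After t = s + 1 the weight is sⁿ⁻¹ (1 + 1/s)^(ℓ-1) on s > 0. Cutting at s = 1 keeps r = 1/s in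
(0, 1] for the radial part and leaves a compact interval for the rest. -/
theorem kernelG_eq_add_radialKernel (hℓ : 1 ≤ ℓ) (hℓn : ℓ ≤ n) (hθ : Continuous θ)
    (hθs : HasCompactSupport θ) (x y : Euc n) (hxy : x ≠ y) :
    kernelG θ ℓ x y = (∫ s in (0 : ℝ)..1, s ^ (n - ℓ) * (s + 1) ^ (ℓ - 1) * θ (x + s • (x - y)))
      + radialKernel θ (fun r => (1 + r) ^ (ℓ - 1)) 1 x (x - y) := by
  have hshift : kernelG θ ℓ x y
      = ∫ s in Set.Ioi (0 : ℝ), s ^ (n - ℓ) * (s + 1) ^ (ℓ - 1) * θ (x + s • (x - y)) := by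
    rw [kernelG, ← (measurePreserving_add_right volume (1 : ℝ)).setIntegral_preimage_emb
      (measurableEmbedding_addRight 1)]
    have hpre : (fun s : ℝ => s + 1) ⁻¹' Set.Ioi 1 = Set.Ioi 0 := by
      ext s
      simp
    rw [hpre]
    refine setIntegral_congr_fun measurableSet_Ioi fun s _ => ?_
    have hpt : y + (s + 1) • (x - y) = x + s • (x - y) := by module
    simp only [add_sub_cancel_right, hpt]
  have hint : IntegrableOn (fun s : ℝ => s ^ (n - ℓ) * (s + 1) ^ (ℓ - 1) * θ (x + s • (x - y)))
      (Set.Ioi 0) := by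
    -- Off the diagonal s ↦ x + s(x - y) is a closed embedding, so θ along this line has compact
    -- support and the integral can be split.
    have hs : HasCompactSupport fun s : ℝ => θ (x + s • (x - y)) :=
      hθs.comp_isClosedEmbedding ((Homeomorph.addLeft x).isClosedEmbedding.comp
        (isClosedEmbedding_smul_left (sub_ne_zero.2 hxy)))
    exact (Continuous.integrable_of_hasCompactSupport (by fun_prop) hs.mul_left).integrableOn
  rw [hshift, ← Set.Ioc_union_Ioi_eq_Ioi zero_le_one,
    setIntegral_union (Set.Ioc_disjoint_Ioi le_rfl) measurableSet_Ioi
    (hint.mono_set Set.Ioc_subset_Ioi_self) (hint.mono_set (Set.Ioi_subset_Ioi zero_le_one)),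
    intervalIntegral.integral_of_le zero_le_one]
  congr 1
  refine setIntegral_congr_fun measurableSet_Ioi fun s hs => ?_
  have hs0 : s ≠ 0 := (zero_lt_one.trans (show (1 : ℝ) < s from hs)).ne'
  have h2 : n - 1 = (n - ℓ) + (ℓ - 1) := by omega
  have h3 : s + 1 = s * (1 + s⁻¹) := by field_simp
  simp only
  rw [h2, h3, mul_pow, pow_add, one_mul]
  ring

/-- The part of the Bogovskiĭ kernel that is smooth across the diagonal. -/
noncomputable def smoothKernelPart (θ : Euc n → ℝ) (ℓ : ℕ) (x y : Euc n) : ℝ :=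
  ∫ s in (0 : ℝ)..1, s ^ (n - ℓ) * (s + 1) ^ (ℓ - 1) * θ (x + s • (x - y))

theorem contDiff_smoothKernelPart (hθ : ContDiff ℝ ∞ θ) (ℓ : ℕ) :
    ContDiff ℝ ∞ fun q : Euc n × Euc n => smoothKernelPart θ ℓ q.1 q.2 := by
  refine contDiff_intervalIntegral_of_contDiff (F := fun (q : Euc n × Euc n) (s : ℝ) =>
    s ^ (n - ℓ) * (s + 1) ^ (ℓ - 1) * θ (q.1 + s • (q.1 - q.2))) ?_ 0 1
  fun_prop

/-- The smoothing kernel of the Bogovskiĭ operator. -/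
noncomputable def smoothingKernel (θ : Euc n → ℝ) (ℓ : ℕ) (x y : Euc n) :
    Form n ℓ →ₗ[ℂ] Form n (ℓ - 1) :=
  contractCombination ℓ fun j => ((smoothKernelPart θ ℓ x y * (x - y) j : ℝ) : ℂ)

theorem smoothingKernel_apply (x y : Euc n) (w : Form n ℓ) :
    smoothingKernel θ ℓ x y w = smoothKernelPart θ ℓ x y • contract (x - y) w := by
  rw [smoothingKernel, contractCombination_apply, smul_contract_eq_sum]

theorem contDiff_smoothingKernel_coefficient (hθ : ContDiff ℝ ∞ θ) (ℓ : ℕ) (j : Fin n) :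
    ContDiff ℝ ∞ fun q : Euc n × Euc n =>
      ((smoothKernelPart θ ℓ q.1 q.2 * (q.1 - q.2) j : ℝ) : ℂ) :=
  Complex.ofRealCLM.contDiff.comp ((contDiff_smoothKernelPart hθ ℓ).mul
    ((EuclideanSpace.proj (𝕜 := ℝ) j).contDiff.comp (contDiff_fst.sub contDiff_snd)))

theorem isSmoothKernel_smoothingKernel (hθ : ContDiff ℝ ∞ θ) (ℓ : ℕ) :
    IsSmoothKernel (smoothingKernel (n := n) θ ℓ) := by
  intro w v
  simp only [smoothingKernel, contractCombination_apply_apply]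
  exact ContDiff.sum fun j _ => contDiff_const.mul (contDiff_smoothingKernel_coefficient hθ ℓ j)

theorem integrable_smoothingKernel (hθ : ContDiff ℝ ∞ θ) {u : Euc n → Form n ℓ}
    (hu : Continuous u) (hus : HasCompactSupport u) (x : Euc n) :
    Integrable fun y => smoothingKernel θ ℓ x y (u y) := by
  simp only [smoothingKernel, contractCombination_apply]
  exact integrable_sum_smul_of_hasCompactSupport
    (fun j => (contDiff_smoothingKernel_coefficient hθ ℓ j).continuous.comp
      (Continuous.prodMk_right x))
    (fun j => (contractCLM (EuclideanSpace.single j 1) ℓ).continuous.comp hu)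
    (fun j => hus.comp_left (g := contractCLM (EuclideanSpace.single j 1) ℓ) (map_zero _))

theorem bogovskiiIntegrand_eq_add (hℓ : 1 ≤ ℓ) (hℓn : ℓ ≤ n) (hθ : Continuous θ)
    (hθs : HasCompactSupport θ) (u : Euc n → Form n ℓ) (x : Euc n) :
    bogovskiiIntegrand θ ℓ u x = fun y => smoothingKernel θ ℓ x y (u y)
      + radialKernel θ (fun r => (1 + r) ^ (ℓ - 1)) 1 x (x - y) • contract (x - y) (u y) := by
  funext y
  rw [bogovskiiIntegrand, smoothingKernel_apply]
  refine Eq.trans ?_ (add_smul _ _ _)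
  -- The kernel splitting needs x ≠ y; on the diagonal the contraction with x - y = 0 makes both
  -- sides vanish.
  rcases eq_or_ne x y with rfl | hxy
  · rw [sub_self, contract_zero]
    exact (smul_zero (M := ℝ) (A := Form n (ℓ - 1)) _).trans
      (smul_zero (M := ℝ) (A := Form n (ℓ - 1)) _).symm
  · rw [kernelG_eq_add_radialKernel hℓ hℓn hθ hθs x y hxy, smoothKernelPart]

end

theorem theorem3p2 (n ℓ : ℕ) (hℓ : 1 ≤ ℓ) (hℓn : ℓ ≤ n) (θ : Euc n → ℝ)
    (hθ_smooth : ContDiff ℝ ∞ θ) (hθ_supp : HasCompactSupport θ) (hθ_int : ∫ x, θ x = 1) :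
    (∀ u : Euc n → Form n ℓ, ContDiff ℝ ∞ u → HasCompactSupport u → ∀ x : Euc n,
      Integrable (poincareIntegrand θ ℓ u x) ∧ Integrable (bogovskiiIntegrand θ ℓ u x)) ∧
    IsPseudodifferentialOperator (-1) (poincareOp θ ℓ) ∧
    IsPseudodifferentialOperator (-1) (bogovskiiOp θ ℓ) := by
  have hn : 1 ≤ n := hℓ.trans hℓn
  have hp₁ : ContDiff ℝ ∞ fun r : ℝ => (1 - r) ^ (ℓ - 1) := by fun_prop
  have hp₂ : ContDiff ℝ ∞ fun r : ℝ => (1 + r) ^ (ℓ - 1) := by fun_prop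
  have hR : ∀ (u : Euc n → Form n ℓ) (x : Euc n), poincareIntegrand θ ℓ u x = fun y =>
      radialKernel θ (fun r => (1 - r) ^ (ℓ - 1)) (-1) x (x - y) • contract (x - y) (u y) :=
    fun u x => funext fun y => by
      rw [poincareIntegrand, kernelG_swap_eq_radialKernel hℓ hℓn]
  have hmain₁ := fun (u : Euc n → Form n ℓ) (hu : ContDiff ℝ ∞ u) (hus : HasCompactSupport u) =>
    integral_radialKernel_contract (σ := -1) hn hp₁ hθ_smooth hθ_supp (by norm_num) hu hus
  have hmain₂ := fun (u : Euc n → Form n ℓ) (hu : ContDiff ℝ ∞ u) (hus : HasCompactSupport u) =>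
    integral_radialKernel_contract (σ := 1) hn hp₂ hθ_smooth hθ_supp one_ne_zero hu hus
  have hT := bogovskiiIntegrand_eq_add hℓ hℓn hθ_smooth.continuous hθ_supp
  refine ⟨fun u hu hus x => ⟨?_, ?_⟩, ?_, ?_⟩
  · rw [hR]
    exact (hmain₁ u hu hus x).1
  · rw [hT]
    exact (integrable_and_integral_fun_add
      (integrable_smoothingKernel hθ_smooth hu.continuous hus x) (hmain₂ u hu hus x).1).1
  -- The Poincaré operator is exactly a quantization, so its smoothing kernel is 0.
  · refine ⟨_, isFormSymbol_radialSymbol hp₁ hθ_smooth hθ_supp (by norm_num : (-1 : ℝ) ^ 2 = 1),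
      0, fun w v => contDiff_const, fun u hu hus x => ?_⟩
    rw [poincareOp, hR, (hmain₁ u hu hus x).2]
    simp
  · refine ⟨_, isFormSymbol_radialSymbol hp₂ hθ_smooth hθ_supp (by norm_num : (1 : ℝ) ^ 2 = 1),
      _, isSmoothKernel_smoothingKernel hθ_smooth ℓ, fun u hu hus x => ?_⟩
    rw [bogovskiiOp, hT, ← (hmain₂ u hu hus x).2]
    exact (integrable_and_integral_fun_add
      (integrable_smoothingKernel hθ_smooth hu.continuous hus x) (hmain₂ u hu hus x).1).2
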